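/- **Setting.** Let $Z$ be a real Hilbert space with a compatible complex structure $\sigma$ and a countable unitary basis $(z_k)_{1\le k\le m}$ of $(Z,\sigma)$, $m\in\{0,1,2,\dots\}\cup\{\infty\}$ (for $m=\infty$, $k$ runs over $1,2,\dots$), so that $\{z_k,\sigma(z_k)\}_k$ is a real orthonormal basis of $Z$. Let $C(Z)$ be the real Clifford algebra with relations $zw+wz+2(z,w)1=0$. Let $X=\{0,1\}^m$ be the group of sequences $x=(x_1,x_2,\dots)$ under componentwise addition mod $2$, with the $\sigma$-algebra generated by the sets $\{x: x_k=1\}$; let $\delta_k\in X$ have $k$-th component $1$ and all others $0$, let $\Delta$ be the subgroup of sequences with finitely many ones, and put $\mathbf 1-x=(1-x_1,1-x_2,\dots)$. For $n\in\{1,2,\dots,\infty\}$ let $H_n\subseteq\ell^2(\mathbb N,\mathbb C)$ be the closed span of the first $n$ basis vectors ($H_\infty=\ell^2$). Let $(\mu,\nu,\{c_k\})$ be a triple in which * $\mu$ is a $\sigma$-finite positive measure on $X$ such that for every $\delta\in\Delta$ the translate $\mu_\delta(E)=\mu(E+\delta)$ has the same null sets as $\mu$; * $\nu:X\to\{1,2,\dots\}\cup\{\infty\}$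 is measurable and, for every $\delta\in\Delta$, $\nu(x+\delta)=\nu(x)$ for almost all $x$; put $H_x=H_{\nu(x)}$, so that $H_{x+\delta}=H_x$ for almost all $x$; * for each $k$, $c_k(x)$ is a unitary operator of $H_x=H_{x+\delta_k}$ for almost all $x$, depending measurably on $x$, with $c_k(x)^*=c_k(x+\delta_k)$ and $c_k(x)c_l(x+\delta_k)=c_l(x)c_k(x+\delta_l)$ for all $k,l$ and almost all $x$. The associated Gårding–Wightman module is the complex Hilbert space $H=\int_X^\oplus H_x\,d\mu(x)$ with the representation $\mathbb J$ of $C(Z)$ given by the bounded operators $$(\mathbb J_{z_k}f)(x)=(-1)^{x_1+\dots+x_{k-1}+1}\,i\,c_k(x)\sqrt{\frac{d\mu_{\delta_k}}{d\mu}(x)}\;f(x+\delta_k),\qquad(\mathbb J_{\sigma(z_k)}f)(x)=(-1)^{x_k}\,i\,(\mathbb J_{z_k}f)(x),$$ extended to all $z\in Z$ by $\mathbb J_z=\sum_k (z_k,z)\,\mathbb J_{z_k}+(\sigma(z_k),z)\,\mathbb J_{\sigma(z_k)}$. A $C(Z)$-invariant real form of $H$ is a closed real subspace $V\subseteq H$,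 stable under $C(Z)$, on which the inner product of $H$ takes real values and such that $H=V\oplus iV$. **Theorem.** $H$ has a $C(Z)$-invariant real form if and only if the following three conditions hold: 1. $\mu$ and its reflection $\tilde\mu(E)=\mu(\mathbf 1-E)$ have the same null sets; 2. $\nu(\mathbf 1-x)=\nu(x)$ for almost all $x\in X$ (so that $H_{\mathbf 1-x}=H_x$ for almost all $x$); 3. there is a measurable family of operators $r(x):H_x\to H_{\mathbf 1-x}=H_x$ which, for almost all $x$, are antilinear and norm-preserving and satisfy, for all $k$, $$r(x)\,r(\mathbf 1-x)=1,\qquad r(x)\,c_k(\mathbf 1-x)=(-1)^k\,c_k(x)\,r(x+\delta_k).$$ -/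

import Mathlib

open MeasureTheory
open scoped ENNReal

noncomputable section

namespace GW

/-! ### Clifford representations from anticommuting complex structures -/

section Clifford

variable {ι Z H : Type*} [NormedAddCommGroup Z] [InnerProductSpace ℝ Z]
  [NormedAddCommGroup H] [InnerProductSpace ℝ H]

/-- The quadratic form `z ↦ -|z|²`; its Clifford algebra has the relations
`z₁ z₂ + z₂ z₁ + 2 (z₁, z₂) 1 = 0`. -/
def negNormSq (Z : Type*) [NormedAddCommGroup Z] [InnerProductSpace ℝ Z] : QuadraticForm ℝ Z :=
  -LinearMap.BilinMap.toQuadraticMap (innerₗ Z)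

theorem negNormSq_apply (z : Z) : negNormSq Z z = -‖z‖ ^ 2 := by
  simp [negNormSq]

variable {T : ι → H →ₗᵢ[ℝ] H}

theorem inner_left_eq (hsq : ∀ i f, T i (T i f) = -f) (i : ι) (f g : H) :
    inner ℝ (T i f) g = -inner ℝ f (T i g) := by
  have : g = T i (-(T i g)) := by rw [map_neg, hsq, neg_neg]
  rw [this, LinearIsometry.inner_map_map, inner_neg_right, ← this]

theorem orthogonalFamily (hsq : ∀ i f, T i (T i f) = -f)
    (hac : ∀ i j, i ≠ j → ∀ f, T i (T j f) = -T j (T i f)) (f : H) :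
    OrthogonalFamily ℝ (fun _ : ι => Submodule.span ℝ {f})
      (fun i => (T i).comp (Submodule.span ℝ {f}).subtypeₗᵢ) := by
  intro i j hij v w
  obtain ⟨a, ha⟩ := Submodule.mem_span_singleton.1 v.2
  obtain ⟨b, hb⟩ := Submodule.mem_span_singleton.1 w.2
  have h1 : inner ℝ (T i f) (T j f) = 0 := by
    have e1 := inner_left_eq hsq i f (T j f)
    have e2 := inner_left_eq hsq j f (T i f)
    rw [hac i j hij, inner_neg_right, neg_neg] at e1
    rw [real_inner_comm, e1] at e2
    linarith
  simp [← ha, ← hb, inner_smul_left, inner_smul_right, h1]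

theorem summable_coeff (b : HilbertBasis ι ℝ Z) [CompleteSpace H]
    (hsq : ∀ i f, T i (T i f) = -f)
    (hac : ∀ i j, i ≠ j → ∀ f, T i (T j f) = -T j (T i f)) (z : Z) (f : H) :
    Summable fun i => inner ℝ (b i) z • T i f := by
  have h := (orthogonalFamily hsq hac f).summable_iff_norm_sq_summable
    (fun i => inner ℝ (b i) z • ⟨f, Submodule.mem_span_singleton_self f⟩)
  simp only [map_smul] at h
  refine h.2 ?_
  have h2 := (b.summable_inner_mul_inner z z).mul_right (‖f‖ ^ 2)
  refine h2.congr fun i => ?_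
  rw [norm_smul, mul_pow, real_inner_comm, Real.norm_eq_abs, sq_abs]
  simp [sq]

theorem norm_tsum_coeff (b : HilbertBasis ι ℝ Z) [CompleteSpace H]
    (hsq : ∀ i f, T i (T i f) = -f)
    (hac : ∀ i j, i ≠ j → ∀ f, T i (T j f) = -T j (T i f)) (z : Z) (f : H) :
    ‖∑' i, inner ℝ (b i) z • T i f‖ = ‖z‖ * ‖f‖ := by
  have h1 := ((summable_coeff b hsq hac z f).hasSum.norm).pow 2
  have h2 : HasSum (fun i => ‖inner ℝ (b i) z • T i f‖ ^ 2) (‖z‖ ^ 2 * ‖f‖ ^ 2) := by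
    have := (b.hasSum_inner_mul_inner z z).mul_right (‖f‖ ^ 2)
    rw [real_inner_self_eq_norm_sq] at this
    refine this.congr_fun fun i => ?_
    rw [norm_smul, mul_pow, real_inner_comm, Real.norm_eq_abs, sq_abs,
      LinearIsometry.norm_map]
    ring
  have h3 : ∀ s : Finset ι, ‖∑ i ∈ s, inner ℝ (b i) z • T i f‖ ^ 2
      = ∑ i ∈ s, ‖inner ℝ (b i) z • T i f‖ ^ 2 := by
    intro s
    have := (orthogonalFamily hsq hac f).norm_sum
      (fun i => inner ℝ (b i) z • ⟨f, Submodule.mem_span_singleton_self f⟩) s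
    simp only [map_smul] at this
    refine this.trans (Finset.sum_congr rfl fun i _ => ?_)
    simp [norm_smul]
  simp only [h3] at h1
  have := tendsto_nhds_unique h1 h2
  rw [← mul_pow] at this
  exact (pow_left_inj₀ (norm_nonneg _) (by positivity) two_ne_zero).1 this

/-- The operator `∑ᵢ (bᵢ, z) Tᵢ` attached to a vector `z` with coordinates `(bᵢ, z)`. -/
def vectorOp (b : HilbertBasis ι ℝ Z) [CompleteSpace H] (T : ι → H →ₗᵢ[ℝ] H)
    (hsq : ∀ i f, T i (T i f) = -f)
    (hac : ∀ i j, i ≠ j → ∀ f, T i (T j f) = -T j (T i f)) : Z →ₗ[ℝ] (H →L[ℝ] H) where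
  toFun z := LinearMap.mkContinuous
    { toFun := fun f => ∑' i, inner ℝ (b i) z • T i f
      map_add' := fun f g => by
        rw [← (summable_coeff b hsq hac z f).tsum_add (summable_coeff b hsq hac z g)]
        simp
      map_smul' := fun a f => by
        rw [RingHom.id_apply, ← (summable_coeff b hsq hac z f).tsum_const_smul]
        simp [smul_comm a] }
    ‖z‖ fun f => (norm_tsum_coeff b hsq hac z f).le
  map_add' z w := by
    ext f
    simp only [LinearMap.mkContinuous_apply, LinearMap.coe_mk, AddHom.coe_mk,
      add_apply]
    rw [← (summable_coeff b hsq hac z f).tsum_add (summable_coeff b hsq hac w f)]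
    simp [inner_add_right, add_smul]
  map_smul' a z := by
    ext f
    simp only [LinearMap.mkContinuous_apply, LinearMap.coe_mk, AddHom.coe_mk,
      smul_apply, RingHom.id_apply]
    rw [← (summable_coeff b hsq hac z f).tsum_const_smul]
    simp [inner_smul_right, mul_smul]

theorem vectorOp_apply (b : HilbertBasis ι ℝ Z) [CompleteSpace H]
    (hsq : ∀ i f, T i (T i f) = -f)
    (hac : ∀ i j, i ≠ j → ∀ f, T i (T j f) = -T j (T i f)) (z : Z) (f : H) :
    vectorOp b T hsq hac z f = ∑' i, inner ℝ (b i) z • T i f := rfl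

theorem vectorOp_mul_self (b : HilbertBasis ι ℝ Z) [CompleteSpace H]
    (hsq : ∀ i f, T i (T i f) = -f)
    (hac : ∀ i j, i ≠ j → ∀ f, T i (T j f) = -T j (T i f)) (z : Z) :
    vectorOp b T hsq hac z * vectorOp b T hsq hac z
      = algebraMap ℝ (H →L[ℝ] H) (negNormSq Z z) := by
  set J := vectorOp b T hsq hac z with hJ
  have hskew : ∀ f g, inner ℝ (J f) g = -inner ℝ f (J g) := by
    intro f g
    have e1 := ((summable_coeff b hsq hac z f).hasSum.mapL ((innerSL ℝ) g))
    have e2 := ((summable_coeff b hsq hac z g).hasSum.mapL ((innerSL ℝ) f)).neg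
    simp only [innerSL_apply_apply, inner_smul_right] at e1 e2
    have e3 := e1.unique (e2.congr_fun fun i => by
      rw [real_inner_comm (T i f) g, inner_left_eq hsq]; ring)
    rw [real_inner_comm]
    exact e3
  have hinner : ∀ f g, inner ℝ (J f) (J g) = ‖z‖ ^ 2 * inner ℝ f g := by
    intro f g
    have hn : ∀ f, ‖J f‖ = ‖z‖ * ‖f‖ := norm_tsum_coeff b hsq hac z
    rw [real_inner_eq_norm_add_mul_self_sub_norm_mul_self_sub_norm_mul_self_div_two,
      real_inner_eq_norm_add_mul_self_sub_norm_mul_self_sub_norm_mul_self_div_two,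
      ← map_add, hn, hn, hn]
    ring
  ext f
  refine ext_inner_right ℝ fun g => ?_
  rw [mul_apply_eq_comp, hskew, hinner, negNormSq_apply]
  simp [ContinuousLinearMap.algebraMap_apply, inner_smul_left, sq, mul_assoc]

/-- The representation of the Clifford algebra of `Z` that sends the vector `z` to
`∑ᵢ (bᵢ, z) Tᵢ`, for orthogonal, mutually anticommuting complex structures `Tᵢ`. -/
def cliffordRep (b : HilbertBasis ι ℝ Z) [CompleteSpace H] (T : ι → H →ₗᵢ[ℝ] H)
    (hsq : ∀ i f, T i (T i f) = -f)
    (hac : ∀ i j, i ≠ j → ∀ f, T i (T j f) = -T j (T i f)) :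
    CliffordAlgebra (negNormSq Z) →ₐ[ℝ] (H →L[ℝ] H) :=
  CliffordAlgebra.lift (negNormSq Z) ⟨vectorOp b T hsq hac, vectorOp_mul_self b hsq hac⟩

end Clifford

/-! ### Occupation numbers -/

/-- The indices `k = 1, 2, …`, bounded by `m` when `m` is finite. -/
abbrev Idx (m : ℕ∞) : Type := {k : ℕ // 1 ≤ k ∧ (k : ℕ∞) ≤ m}

/-- The group `X` of sequences `(x₁, x₂, …)` of zeros and ones under addition modulo `2`. It carries
the product `σ`-algebra, which is generated by the sets `{x | x k = 1}`. -/
abbrev Occ (m : ℕ∞) : Type := Idx m → ZMod 2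

/-- The subgroup `Δ` of the sequences with finitely many ones. -/
def Fin01 (m : ℕ∞) : Set (Occ m) := {x | {k | x k = 1}.Finite}

/-- The sequence `δ_k` with `k`-th component `1` and all others `0`. -/
def delta {m : ℕ∞} (k : Idx m) : Occ m := Pi.single k 1

instance instLocallyFiniteOrderBotIdx (m : ℕ∞) : LocallyFiniteOrderBot (Idx m) := by
  classical infer_instance

/-- `x₁ + … + x_{k-1}`, as a natural number. -/
def partialSum {m : ℕ∞} (k : Idx m) (x : Occ m) : ℕ := ∑ j ∈ Finset.Iio k, (x j).val

/-- The Hilbert space `ℓ²` that contains all the fibres. -/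
abbrev Ell2 : Type := lp (fun _ : ℕ => ℂ) 2

/-- The model `H_n ⊆ ℓ²` of the Hilbert space of dimension `n ∈ {0, 1, …, ∞}`: the vectors
whose coordinates vanish from the `n`-th on (counting from `0`). -/
def fiber (n : ℕ∞) : Submodule ℂ Ell2 where
  carrier := {v | ∀ i : ℕ, n ≤ i → v i = 0}
  add_mem' hu hv i hi := by simp [hu i hi, hv i hi]
  zero_mem' i _ := by simp
  smul_mem' a v hv i hi := by simp [hv i hi]

theorem isClosed_fiber (n : ℕ∞) : IsClosed (fiber n : Set Ell2) := by
  have : (fiber n : Set Ell2) = ⋂ (i : ℕ) (_ : n ≤ i), {v | v i = 0} := by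
    ext v
    simp only [Set.mem_iInter, Set.mem_ofPred_eq]
    rfl
  rw [this]
  refine isClosed_iInter fun i => isClosed_iInter fun _ => ?_
  exact isClosed_eq (lp.evalCLM ℂ (fun _ : ℕ => ℂ) 2 i).continuous continuous_const

/-- `U` restricts to a unitary operator of the closed subspace `F` and vanishes on the orthogonal
complement of `F`. This is how operators of a fibre are regarded as operators on `ℓ²`. -/
structure IsUnitaryOn (F : Submodule ℂ Ell2) (U : Ell2 →L[ℂ] Ell2) : Prop where
  mem : ∀ v ∈ F, U v ∈ F
  norm_eq : ∀ v ∈ F, ‖U v‖ = ‖v‖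
  surj : ∀ w ∈ F, ∃ v ∈ F, U v = w
  zero : ∀ v ∈ Fᗮ, U v = 0

/-- The parameters `(μ, ν, {c_k})` of a Gårding–Wightman module. -/
structure Triple (m : ℕ∞) where
  /-- the measure on occupation numbers -/
  μ : Measure (Occ m)
  sigmaFinite : SigmaFinite μ
  /-- all translates of `μ` by `Δ` have the same null sets; as `-δ = δ`, the measure
  `E ↦ μ (E + δ)` is the image of `μ` under `x ↦ x + δ` -/
  quasiInvariant : ∀ δ ∈ Fin01 m, μ.map (· + δ) ≪ μ ∧ μ ≪ μ.map (· + δ)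
  /-- the multiplicity function, with values in `{1, 2, …, ∞}` -/
  ν : Occ m → ℕ∞
  measurable_ν : Measurable ν
  one_le_ν : ∀ x, 1 ≤ ν x
  ν_invariant : ∀ δ ∈ Fin01 m, ∀ᵐ x ∂μ, ν (x + δ) = ν x
  /-- the unitary operators `c_k(x)` of `H_x = H_{x + δ_k}` -/
  c : Idx m → Occ m → (Ell2 →L[ℂ] Ell2)
  measurable_c : ∀ k v, StronglyMeasurable fun x => c k x v
  unitary_c : ∀ k, ∀ᵐ x ∂μ, IsUnitaryOn (fiber (ν x)) (c k x)
  adjoint_c : ∀ k, ∀ᵐ x ∂μ, ContinuousLinearMap.adjoint (c k x) = c k (x + delta k)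
  comm_c : ∀ k l, ∀ᵐ x ∂μ,
    (c k x) ∘L (c l (x + delta k)) = (c l x) ∘L (c k (x + delta l))

variable {m : ℕ∞}

theorem Occ.add_self (x : Occ m) : x + x = 0 := by
  ext k
  exact CharTwo.add_self_eq_zero (x k)

theorem Occ.add_add_cancel (x y : Occ m) : x + y + y = x := by
  rw [add_assoc, Occ.add_self, add_zero]

theorem delta_mem (k : Idx m) : delta k ∈ Fin01 m := by
  refine (Set.finite_singleton k).subset fun j hj => ?_
  by_contra h
  simp [delta, Pi.single_eq_of_ne (show j ≠ k from h)] at hj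

/-- Translation by `δ` as a measurable automorphism of `X`. -/
def translate (δ : Occ m) : Occ m ≃ᵐ Occ m := MeasurableEquiv.addRight δ

namespace Triple

variable (T : Triple m)

instance instSigmaFinite : SigmaFinite T.μ := T.sigmaFinite

instance instSigmaFiniteMap (δ : Occ m) : SigmaFinite (T.μ.map (· + δ)) :=
  (translate δ).sigmaFinite_map

theorem quasiMeasurePreserving {δ : Occ m} (hδ : δ ∈ Fin01 m) :
    Measure.QuasiMeasurePreserving (· + δ) T.μ T.μ :=
  ⟨measurable_add_const δ, (T.quasiInvariant δ hδ).1⟩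

/-- A property that holds almost everywhere holds at almost every translate. -/
theorem ae_translate {p : Occ m → Prop} {δ : Occ m} (hδ : δ ∈ Fin01 m) (h : ∀ᵐ x ∂T.μ, p x) :
    ∀ᵐ x ∂T.μ, p (x + δ) :=
  (T.quasiMeasurePreserving hδ).ae h

/-- The Radon–Nikodym derivative `dμ(x + δ) / dμ(x)`. -/
def density (δ : Occ m) : Occ m → ℝ≥0∞ := (T.μ.map (· + δ)).rnDeriv T.μ

theorem density_cocycle {δ δ' : Occ m} (hδ : δ ∈ Fin01 m) (hδ' : δ' ∈ Fin01 m) :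
    ∀ᵐ x ∂T.μ, T.density δ x * T.density δ' (x + δ)
      = (T.μ.map (· + (δ + δ'))).rnDeriv T.μ x := by
  have hmap : (T.μ.map (· + δ')).map (· + δ) = T.μ.map (· + (δ + δ')) := by
    rw [Measure.map_map (measurable_add_const _) (measurable_add_const _)]
    congr 1; ext x; simp [add_assoc, add_comm δ]
  have h1 := Measure.rnDeriv_mul_rnDeriv (κ := T.μ) (μ := T.μ.map (· + (δ + δ')))
    (ν := T.μ.map (· + δ)) (by
      rw [← hmap]; exact (T.quasiInvariant δ' hδ').1.map (measurable_add_const δ))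
  have h2 := T.ae_translate hδ ((translate δ).measurableEmbedding.rnDeriv_map
    (T.μ.map (· + δ')) T.μ)
  filter_upwards [h1, h2] with x h1 h2
  rw [← h1, Pi.mul_apply, mul_comm]
  congr 1
  rw [density, ← h2]
  change ((T.μ.map (· + δ')).map (· + δ)).rnDeriv (T.μ.map (· + δ)) (x + δ + δ) = _
  rw [hmap, Occ.add_add_cancel]

theorem density_mul_self {δ : Occ m} (hδ : δ ∈ Fin01 m) :
    ∀ᵐ x ∂T.μ, T.density δ x * T.density δ (x + δ) = 1 := by
  filter_upwards [T.density_cocycle hδ hδ, T.μ.rnDeriv_self] with x h1 h2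
  rw [h1, Occ.add_self]
  simpa using h2

theorem density_comm {δ δ' : Occ m} (hδ : δ ∈ Fin01 m) (hδ' : δ' ∈ Fin01 m) :
    ∀ᵐ x ∂T.μ, T.density δ x * T.density δ' (x + δ)
      = T.density δ' x * T.density δ (x + δ') := by
  filter_upwards [T.density_cocycle hδ hδ', T.density_cocycle hδ' hδ] with x h1 h2
  rw [h1, h2, add_comm]

/-- `∫ g(x + δ) dμ(x + δ)/dμ(x) dμ(x) = ∫ g dμ`. -/
theorem lintegral_density {δ : Occ m} (hδ : δ ∈ Fin01 m) {g : Occ m → ℝ≥0∞}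
    (hg : AEMeasurable g T.μ) :
    ∫⁻ x, T.density δ x * g (x + δ) ∂T.μ = ∫⁻ x, g x ∂T.μ := by
  refine (lintegral_rnDeriv_mul (T.quasiInvariant δ hδ).1
    (hg.comp_quasiMeasurePreserving (T.quasiMeasurePreserving hδ))).trans ?_
  refine (lintegral_map_equiv _ (translate δ)).trans ?_
  refine lintegral_congr fun x => ?_
  change g (x + δ + δ) = g x
  rw [Occ.add_add_cancel]

/-- The direct integral `∫⊕ H_x dμ(x)`: the square integrable `f : X → ℓ²` with `f(x) ∈ H_x`
almost everywhere, where `H_x = H_{ν(x)}`. -/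
def space : Submodule ℂ (Lp Ell2 2 T.μ) where
  carrier := {f | ∀ᵐ x ∂T.μ, f x ∈ fiber (T.ν x)}
  add_mem' {f g} hf hg := by
    filter_upwards [hf, hg, Lp.coeFn_add f g] with x h1 h2 h3
    rw [h3]; exact add_mem h1 h2
  zero_mem' := by
    filter_upwards [Lp.coeFn_zero Ell2 2 T.μ] with x h
    rw [h]; exact zero_mem _
  smul_mem' a f hf := by
    filter_upwards [hf, Lp.coeFn_smul a f] with x h1 h2
    rw [h2]; exact Submodule.smul_mem _ a h1

theorem isClosed_space : IsClosed (T.space : Set (Lp Ell2 2 T.μ)) := by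
  refine IsSeqClosed.isClosed fun u f hu hf => ?_
  obtain ⟨ns, _, hns⟩ := (tendstoInMeasure_of_tendsto_Lp hf).exists_seq_tendsto_ae
  have hu' : ∀ᵐ x ∂T.μ, ∀ n, u n x ∈ fiber (T.ν x) := ae_all_iff.2 hu
  change ∀ᵐ x ∂T.μ, f x ∈ fiber (T.ν x)
  filter_upwards [hns, hu'] with x h1 h2
  exact (isClosed_fiber _).mem_of_tendsto h1 (Filter.Eventually.of_forall fun n => h2 _)

/-- The complex Hilbert space `H = ∫⊕ H_x dμ(x)`. -/
def Space : Type := T.space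

instance instNormedAddCommGroup : NormedAddCommGroup T.Space :=
  inferInstanceAs (NormedAddCommGroup T.space)

instance instInnerProductSpace : InnerProductSpace ℂ T.Space :=
  inferInstanceAs (InnerProductSpace ℂ T.space)

/-- The underlying real Hilbert space, with inner product `Re (f, g)`. -/
instance instRealInnerProductSpace : InnerProductSpace ℝ T.Space :=
  InnerProductSpace.complexToReal

instance instCompleteSpace : CompleteSpace T.Space :=
  T.isClosed_space.completeSpace_coe

end Triple

/-- Pointwise application of a strongly measurable family of operators to a strongly measurable
function. -/
theorem stronglyMeasurable_apply {A : Occ m → (Ell2 →L[ℂ] Ell2)}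
    (hA : ∀ v, StronglyMeasurable fun x => A x v) {f : Occ m → Ell2} (hf : StronglyMeasurable f) :
    StronglyMeasurable fun x => A x (f x) := by
  refine stronglyMeasurable_of_tendsto Filter.atTop (f := fun n x => A x (hf.approx n x)) ?_ ?_
  · intro n
    have : (fun x => A x (hf.approx n x)) = fun x => ∑ v ∈ (hf.approx n).range,
        (hf.approx n ⁻¹' {v}).indicator (fun x => A x v) x := by
      ext1 x
      rw [Finset.sum_eq_single (hf.approx n x)]
      · simp
      · intro v _ hv
        exact Set.indicator_of_notMem (fun h => hv (by simpa using h.symm)) _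
      · intro h; exact absurd (SimpleFunc.mem_range_self _ x) h
    rw [this]
    exact Finset.stronglyMeasurable_fun_sum _ fun v _ =>
      (hA v).indicator (SimpleFunc.measurableSet_fiber _ _)
  · rw [tendsto_pi_nhds]
    intro x
    exact ((A x).continuous.tendsto _).comp (hf.tendsto_approx x)


namespace Triple

variable (T : Triple m)

/-- The function `x ↦ a(x) √(dμ(x + δ_k)/dμ(x)) c_k(x) f(x + δ_k)`. -/
def opFun (a : Occ m → ℂ) (k : Idx m) (f : Occ m → Ell2) (x : Occ m) : Ell2 :=
  (a x * (Real.sqrt (T.density (delta k) x).toReal : ℂ)) • T.c k x (f (x + delta k))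

theorem aestronglyMeasurable_opFun {a : Occ m → ℂ} (ha : Measurable a) (k : Idx m)
    {f : Occ m → Ell2} (hf : AEStronglyMeasurable f T.μ) :
    AEStronglyMeasurable (T.opFun a k f) T.μ := by
  obtain ⟨g, hg, hfg⟩ := hf
  refine ⟨T.opFun a k g, ?_, ?_⟩
  · have hd : Measurable (T.density (delta k)) := Measure.measurable_rnDeriv _ _
    have hs : Measurable fun x => a x * (Real.sqrt (T.density (delta k) x).toReal : ℂ) := by
      fun_prop
    exact hs.stronglyMeasurable.smul
      (stronglyMeasurable_apply (T.measurable_c k) (hg.comp_measurable (measurable_add_const _)))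
  · filter_upwards [T.ae_translate (delta_mem k) hfg] with x hx
    simp only [opFun, hx]

theorem opFun_congr (a : Occ m → ℂ) (k : Idx m) {f g : Occ m → Ell2} (h : f =ᵐ[T.μ] g) :
    T.opFun a k f =ᵐ[T.μ] T.opFun a k g := by
  filter_upwards [T.ae_translate (delta_mem k) h] with x hx
  simp only [opFun, hx]

theorem translate_mem_fiber (k : Idx m) {f : Occ m → Ell2}
    (hf : ∀ᵐ x ∂T.μ, f x ∈ fiber (T.ν x)) :
    ∀ᵐ x ∂T.μ, f (x + delta k) ∈ fiber (T.ν x) := by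
  filter_upwards [T.ae_translate (delta_mem k) hf, T.ν_invariant _ (delta_mem k)] with x h1 h2
  rwa [h2] at h1

theorem opFun_mem_fiber (a : Occ m → ℂ) (k : Idx m) {f : Occ m → Ell2}
    (hf : ∀ᵐ x ∂T.μ, f x ∈ fiber (T.ν x)) :
    ∀ᵐ x ∂T.μ, T.opFun a k f x ∈ fiber (T.ν x) := by
  filter_upwards [T.translate_mem_fiber k hf, T.unitary_c k] with x h1 h2
  exact Submodule.smul_mem _ _ (h2.mem _ h1)

theorem eLpNorm_opFun {a : Occ m → ℂ} (ha : ∀ x, ‖a x‖ = 1) (k : Idx m) {f : Occ m → Ell2}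
    (hfm : AEStronglyMeasurable f T.μ) (hf : ∀ᵐ x ∂T.μ, f x ∈ fiber (T.ν x)) :
    eLpNorm (T.opFun a k f) 2 T.μ = eLpNorm f 2 T.μ := by
  rw [eLpNorm_eq_lintegral_rpow_enorm_toReal two_ne_zero ENNReal.ofNat_ne_top,
    eLpNorm_eq_lintegral_rpow_enorm_toReal two_ne_zero ENNReal.ofNat_ne_top]
  congr 1
  rw [← T.lintegral_density (delta_mem k) (hfm.enorm.pow_const _)]
  refine lintegral_congr_ae ?_
  filter_upwards [T.translate_mem_fiber k hf, T.unitary_c k,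
    Measure.rnDeriv_lt_top (T.μ.map (· + delta k)) T.μ] with x h1 h2 h3
  change T.density (delta k) x < ∞ at h3
  have e1 : ‖T.opFun a k f x‖ₑ
      = ENNReal.ofReal (Real.sqrt (T.density (delta k) x).toReal) * ‖f (x + delta k)‖ₑ := by
    rw [opFun, ← ofReal_norm, ← ofReal_norm, ← ENNReal.ofReal_mul (Real.sqrt_nonneg _), norm_smul,
      h2.norm_eq _ h1, norm_mul, ha, one_mul, Complex.norm_real, Real.norm_of_nonneg
        (Real.sqrt_nonneg _)]
  rw [e1]
  simp only [ENNReal.toReal_ofNat, ENNReal.rpow_ofNat]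
  rw [mul_pow, ← ENNReal.ofReal_pow (Real.sqrt_nonneg _), Real.sq_sqrt ENNReal.toReal_nonneg,
    ENNReal.ofReal_toReal h3.ne]

theorem memLp_opFun {a : Occ m → ℂ} (ha : Measurable a) (ha' : ∀ x, ‖a x‖ = 1) (k : Idx m)
    (f : T.Space) : MemLp (T.opFun a k f.1) 2 T.μ :=
  ⟨T.aestronglyMeasurable_opFun ha k (Lp.aestronglyMeasurable f.1), by
    rw [T.eLpNorm_opFun ha' k (Lp.aestronglyMeasurable f.1) f.2]
    exact Lp.eLpNorm_lt_top f.1⟩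

/-- The operator `f ↦ a(x) √(dμ(x + δ_k)/dμ(x)) c_k(x) f(x + δ_k)` of the direct integral, for a
function `a` of modulus one. -/
def op (a : Occ m → ℂ) (ha : Measurable a) (ha' : ∀ x, ‖a x‖ = 1) (k : Idx m) :
    T.Space →ₗᵢ[ℂ] T.Space where
  toFun f := ⟨(T.memLp_opFun ha ha' k f).toLp (T.opFun a k f.1), by
    have h := T.opFun_mem_fiber a k f.2
    filter_upwards [h, (T.memLp_opFun ha ha' k f).coeFn_toLp] with x h1 h2
    rwa [h2]⟩
  map_add' f g := by
    refine Subtype.ext (Lp.ext ?_)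
    refine (MemLp.coeFn_toLp (T.memLp_opFun ha ha' k (f + g))).trans ?_
    refine .trans ?_ (Lp.coeFn_add _ _).symm
    filter_upwards [T.ae_translate (delta_mem k) (Lp.coeFn_add f.1 g.1),
      (T.memLp_opFun ha ha' k f).coeFn_toLp, (T.memLp_opFun ha ha' k g).coeFn_toLp] with x h h1 h2
    rw [Pi.add_apply, h1, h2]
    change _ • T.c k x ((f.1 + g.1 : Lp Ell2 2 T.μ) (x + delta k)) = _
    simp only [opFun, h, Pi.add_apply, map_add, smul_add]
  map_smul' r f := by
    refine Subtype.ext (Lp.ext ?_)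
    refine (MemLp.coeFn_toLp (T.memLp_opFun ha ha' k (r • f))).trans ?_
    refine .trans ?_ (Lp.coeFn_smul _ _).symm
    filter_upwards [T.ae_translate (delta_mem k) (Lp.coeFn_smul r f.1),
      (T.memLp_opFun ha ha' k f).coeFn_toLp] with x h h1
    rw [RingHom.id_apply, Pi.smul_apply, h1]
    change _ • T.c k x ((r • f.1 : Lp Ell2 2 T.μ) (x + delta k)) = _
    simp only [opFun, h, Pi.smul_apply, map_smul]
    rw [smul_comm]
  norm_map' f := by
    change ‖(T.memLp_opFun ha ha' k f).toLp (T.opFun a k f.1)‖ = ‖f.1‖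
    rw [Lp.norm_toLp, T.eLpNorm_opFun ha' k (Lp.aestronglyMeasurable f.1) f.2, Lp.norm_def]

theorem op_apply (a : Occ m → ℂ) (ha : Measurable a) (ha' : ∀ x, ‖a x‖ = 1) (k : Idx m)
    (f : T.Space) : (T.op a ha ha' k f).1 =ᵐ[T.μ] T.opFun a k f.1 :=
  (T.memLp_opFun ha ha' k f).coeFn_toLp

theorem op_op_apply (a : Occ m → ℂ) (ha : Measurable a) (ha' : ∀ x, ‖a x‖ = 1) (k : Idx m)
    (b : Occ m → ℂ) (hb : Measurable b) (hb' : ∀ x, ‖b x‖ = 1) (l : Idx m) (f : T.Space) :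
    ∀ᵐ x ∂T.μ, (T.op a ha ha' k (T.op b hb hb' l f)).1 x
      = (a x * b (x + delta k) * (Real.sqrt (T.density (delta k) x *
          T.density (delta l) (x + delta k)).toReal : ℂ)) •
        (T.c k x ∘L T.c l (x + delta k)) (f.1 (x + delta k + delta l)) := by
  filter_upwards [T.op_apply a ha ha' k (T.op b hb hb' l f),
    T.opFun_congr a k (T.op_apply b hb hb' l f)] with x h1 h2
  rw [h1, h2]
  simp only [opFun, map_smul, smul_smul, ENNReal.toReal_mul,
    Real.sqrt_mul ENNReal.toReal_nonneg, ContinuousLinearMap.comp_apply]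
  congr 1
  push_cast
  ring

theorem op_op_self (a : Occ m → ℂ) (ha : Measurable a) (ha' : ∀ x, ‖a x‖ = 1) (k : Idx m)
    (haa : ∀ x, a x * a (x + delta k) = -1) (f : T.Space) :
    T.op a ha ha' k (T.op a ha ha' k f) = -f := by
  refine Subtype.ext (Lp.ext ?_)
  refine .trans ?_ (Lp.coeFn_neg _).symm
  filter_upwards [T.op_op_apply a ha ha' k a ha ha' k f, T.density_mul_self (delta_mem k),
    T.adjoint_c k, T.unitary_c k, T.ae_translate (delta_mem k) (T.unitary_c k),
    f.2, T.ν_invariant _ (delta_mem k)] with x h1 h2 h3 h4 h5 h6 h7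
  rw [h1, h2, haa, Occ.add_add_cancel]
  have : (T.c k x ∘L T.c k (x + delta k)) (f.1 x) = f.1 x := by
    rw [h7, ← h3] at h5
    rw [← h3]
    obtain ⟨v, hv, hvw⟩ := h4.surj _ h6
    have hadj : ∀ u ∈ fiber (T.ν x), ContinuousLinearMap.adjoint (T.c k x) (T.c k x u) = u := by
      intro u hu
      have hmem := h5.mem _ (h4.mem _ hu)
      rw [← sub_eq_zero, ← norm_eq_zero, ← sq_eq_zero_iff]
      have e := @norm_sub_sq ℂ _ _ _ _
        (ContinuousLinearMap.adjoint (T.c k x) (T.c k x u)) u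
      rw [ContinuousLinearMap.adjoint_inner_left, h5.norm_eq _ (h4.mem _ hu), h4.norm_eq _ hu,
        inner_self_eq_norm_sq, h4.norm_eq _ hu] at e
      rw [e]; ring
    rw [ContinuousLinearMap.comp_apply, ← hvw, hadj v hv]
  rw [this]
  simp

theorem op_op_anti (a : Occ m → ℂ) (ha : Measurable a) (ha' : ∀ x, ‖a x‖ = 1) (k : Idx m)
    (b : Occ m → ℂ) (hb : Measurable b) (hb' : ∀ x, ‖b x‖ = 1) (l : Idx m)
    (hab : ∀ x, a x * b (x + delta k) = -(b x * a (x + delta l))) (f : T.Space) :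
    T.op a ha ha' k (T.op b hb hb' l f) = -T.op b hb hb' l (T.op a ha ha' k f) := by
  refine Subtype.ext (Lp.ext ?_)
  refine .trans ?_ (Lp.coeFn_neg _).symm
  filter_upwards [T.op_op_apply a ha ha' k b hb hb' l f, T.op_op_apply b hb hb' l a ha ha' k f,
    T.density_comm (delta_mem k) (delta_mem l), T.comm_c k l] with x h1 h2 h3 h4
  rw [Pi.neg_apply, h1, h2, hab, h3, h4, add_right_comm, neg_mul, neg_smul]

end Triple

/-! ### The representation -/

/-- The factor `(-1)^(x₁ + … + x_{k-1} + 1) i` of the operator `J_{z_k}`. -/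
def phaseZ (k : Idx m) (x : Occ m) : ℂ := (-1) ^ (partialSum k x + 1) * Complex.I

/-- The factor `(-1)^(x_k) i · (-1)^(x₁ + … + x_{k-1} + 1) i` of the operator `J_{σ(z_k)}`. -/
def phaseS (k : Idx m) (x : Occ m) : ℂ := (-1) ^ (x k).val * Complex.I * phaseZ k x

theorem measurable_phaseZ (k : Idx m) : Measurable (phaseZ k) := by
  have : Measurable (partialSum k) :=
    Finset.measurable_fun_sum _ fun j _ =>
      (measurable_of_countable (fun a : ZMod 2 => a.val)).comp (measurable_pi_apply j)
  exact (measurable_of_countable (fun n : ℕ => (-1 : ℂ) ^ (n + 1) * Complex.I)).comp this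

theorem measurable_phaseS (k : Idx m) : Measurable (phaseS k) :=
  ((measurable_of_countable (fun a : ZMod 2 => (-1 : ℂ) ^ a.val * Complex.I)).comp
    (measurable_pi_apply k)).mul (measurable_phaseZ k)

theorem norm_phaseZ (k : Idx m) (x : Occ m) : ‖phaseZ k x‖ = 1 := by simp [phaseZ]

theorem norm_phaseS (k : Idx m) (x : Occ m) : ‖phaseS k x‖ = 1 := by
  simp [phaseS, norm_phaseZ]

theorem sign_add_one (a : ZMod 2) : (-1 : ℂ) ^ (a + 1).val = -(-1) ^ a.val := by
  fin_cases a
  · change (-1 : ℂ) ^ 1 = -(-1) ^ 0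
    simp
  · change (-1 : ℂ) ^ 0 = -(-1) ^ 1
    simp

theorem sign_add_delta (k l : Idx m) (x : Occ m) :
    (-1 : ℂ) ^ ((x + delta l) k).val = (if l = k then -1 else 1) * (-1) ^ (x k).val := by
  by_cases h : l = k
  · subst h
    simp [delta, sign_add_one]
  · simp [delta, h]

theorem phaseZ_add_delta (k l : Idx m) (x : Occ m) :
    phaseZ k (x + delta l) = (if l < k then -1 else 1) * phaseZ k x := by
  have : (-1 : ℂ) ^ partialSum k (x + delta l)
      = (if l < k then -1 else 1) * (-1) ^ partialSum k x := by
    simp only [partialSum, ← Finset.prod_pow_eq_pow_sum, sign_add_delta, Finset.prod_mul_distrib]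
    simp [Finset.prod_ite_eq]
  rw [phaseZ, phaseZ, pow_succ, pow_succ, this]
  ring

theorem phaseS_add_delta (k l : Idx m) (x : Occ m) :
    phaseS k (x + delta l)
      = (if l = k then -1 else 1) * (if l < k then -1 else 1) * phaseS k x := by
  rw [phaseS, phaseS, phaseZ_add_delta, sign_add_delta]
  ring

theorem phaseZ_sq (k : Idx m) (x : Occ m) : phaseZ k x * phaseZ k x = -1 := by
  rw [phaseZ, mul_mul_mul_comm, ← mul_pow, Complex.I_mul_I]; simp

theorem phaseS_sq (k : Idx m) (x : Occ m) : phaseS k x * phaseS k x = 1 := by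
  rw [phaseS, mul_mul_mul_comm, phaseZ_sq, mul_mul_mul_comm, ← mul_pow, Complex.I_mul_I]; simp

namespace Triple

variable (T : Triple m)

/-- `(J_{z_k} f)(x) = (-1)^(x₁ + … + x_{k-1} + 1) i c_k(x) √(dμ(x + δ_k)/dμ(x)) f(x + δ_k)`. -/
def opZ (k : Idx m) : T.Space →ₗᵢ[ℂ] T.Space :=
  T.op (phaseZ k) (measurable_phaseZ k) (norm_phaseZ k) k

/-- `(J_{σ(z_k)} f)(x) = (-1)^(x_k) i (J_{z_k} f)(x)`. -/
def opS (k : Idx m) : T.Space →ₗᵢ[ℂ] T.Space :=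
  T.op (phaseS k) (measurable_phaseS k) (norm_phaseS k) k

/-- All the generators: `J_{z_k}` for `inl k` and `J_{σ(z_k)}` for `inr k`, regarded as operators
of the underlying real Hilbert space. -/
def generator : Idx m ⊕ Idx m → (T.Space →ₗᵢ[ℝ] T.Space)
  | .inl k => { (T.opZ k).toLinearMap.restrictScalars ℝ with norm_map' := (T.opZ k).norm_map }
  | .inr k => { (T.opS k).toLinearMap.restrictScalars ℝ with norm_map' := (T.opS k).norm_map }

theorem generator_sq (p : Idx m ⊕ Idx m) (f : T.Space) :
    T.generator p (T.generator p f) = -f := by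
  rcases p with k | k
  · refine T.op_op_self (phaseZ k) (measurable_phaseZ k) (norm_phaseZ k) k
      (fun x => ?_) f
    rw [phaseZ_add_delta, if_neg (lt_irrefl k), one_mul, phaseZ_sq]
  · refine T.op_op_self (phaseS k) (measurable_phaseS k) (norm_phaseS k) k
      (fun x => ?_) f
    rw [phaseS_add_delta, if_neg (lt_irrefl k), if_pos rfl, mul_one, mul_left_comm, phaseS_sq,
      mul_one]

theorem generator_anti (p q : Idx m ⊕ Idx m) (hpq : p ≠ q) (f : T.Space) :
    T.generator p (T.generator q f) = -T.generator q (T.generator p f) := by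
  rcases p with k | k <;> rcases q with l | l
  · refine T.op_op_anti (phaseZ k) (measurable_phaseZ k) (norm_phaseZ k) k
      (phaseZ l) (measurable_phaseZ l) (norm_phaseZ l) l (fun x => ?_) f
    have hkl : k ≠ l := fun h => hpq (by rw [h])
    rw [phaseZ_add_delta, phaseZ_add_delta]
    rcases hkl.lt_or_gt with h | h <;> simp [h, h.not_gt] <;> ring
  · refine T.op_op_anti (phaseZ k) (measurable_phaseZ k) (norm_phaseZ k) k
      (phaseS l) (measurable_phaseS l) (norm_phaseS l) l (fun x => ?_) f
    rw [phaseS_add_delta, phaseZ_add_delta]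
    rcases lt_trichotomy k l with h | h | h
    · simp [h, h.not_gt, h.ne]; ring
    · subst h; simp; ring
    · simp [h, h.not_gt, h.ne']; ring
  · refine T.op_op_anti (phaseS k) (measurable_phaseS k) (norm_phaseS k) k
      (phaseZ l) (measurable_phaseZ l) (norm_phaseZ l) l (fun x => ?_) f
    rw [phaseS_add_delta, phaseZ_add_delta]
    rcases lt_trichotomy k l with h | h | h
    · simp [h, h.not_gt, h.ne']; ring
    · subst h; simp; ring
    · simp [h, h.not_gt, h.ne]; ring
  · refine T.op_op_anti (phaseS k) (measurable_phaseS k) (norm_phaseS k) k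
      (phaseS l) (measurable_phaseS l) (norm_phaseS l) l (fun x => ?_) f
    have hkl : k ≠ l := fun h => hpq (by rw [h])
    rw [phaseS_add_delta, phaseS_add_delta]
    rcases hkl.lt_or_gt with h | h <;> simp [h, h.not_gt, hkl, hkl.symm] <;> ring

/-- The Gårding–Wightman representation `J` of the Clifford algebra `C(Z)` on the direct integral.
The real Hilbert space `Z` comes with an orthonormal basis `b`, where `b (inl k) = z_k` and
`b (inr k) = σ(z_k)` for a compatible complex structure `σ` and a unitary basis `z_1, z_2, …`
of `(Z, σ)`; the vector `z` acts by
`J_z = ∑_k (z_k, z) J_{z_k} + (σ(z_k), z) J_{σ(z_k)}`. -/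
def rep {Z : Type*} [NormedAddCommGroup Z] [InnerProductSpace ℝ Z]
    (b : HilbertBasis (Idx m ⊕ Idx m) ℝ Z) :
    CliffordAlgebra (negNormSq Z) →ₐ[ℝ] (T.Space →L[ℝ] T.Space) :=
  cliffordRep (H := T.Space) b T.generator T.generator_sq T.generator_anti

end Triple

/-- `V` is a `C(Z)`-invariant real form of the complex Hilbert space `H`: a closed real subspace
on which the inner product of `H` is real, with `H = V ⊕ iV` (so that `H` is the complexification
of the real Hilbert space `V`), which is stable under the action `J` of `C(Z)`. -/
structure IsInvariantRealForm {Z H : Type*} [NormedAddCommGroup Z] [InnerProductSpace ℝ Z]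
    [NormedAddCommGroup H] [InnerProductSpace ℂ H]
    (J : CliffordAlgebra (negNormSq Z) →ₐ[ℝ] (H →L[ℝ] H)) (V : Submodule ℝ H) : Prop where
  closed : IsClosed (V : Set H)
  real_inner : ∀ u ∈ V, ∀ v ∈ V, (inner ℂ u v).im = 0
  decomp : ∀ f : H, ∃! p : V × V, (p.1 : H) + Complex.I • (p.2 : H) = f
  invariant : ∀ a, ∀ v ∈ V, J a v ∈ V

end GW

end

/-!
Invariant real forms correspond to antiunitary involutions `R` that commute with all generators.
Since `J_{σ(z_k)} J_{z_k}` is multiplication by `-(-1) ^ x_k * i` and `R` is antilinear, `R` carries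
the elements supported on `{x | x_k = a}` to those supported on `{x | x_k = 1 - a}`, and therefore
those supported on any measurable set `E` to those supported on `1 - E`. Hence `μ` is
quasi-invariant under the reflection `x ↦ 1 - x = x + 1`, and `R` is a weighted shift by `1`,
`(R f)(x) = √(dμ₁/dμ)(x) r(x) f(x + 1)` with antilinear isometries `r(x)`. Composites of weighted
shifts are weighted shifts, and weighted shifts by the same element agree only if their coefficients
agree almost everywhere; comparing coefficients in `R² = 1` and `R J = J R` gives the identities for
`r`, in which the sign `(-1) ^ k` is the effect of conjugation and reflection on the phases of `J`.
-/

noncomputable section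

namespace GW

/-! ### Real forms and conjugations -/

section RealForm

open ComplexConjugate

variable {H : Type*} [NormedAddCommGroup H] [InnerProductSpace ℂ H]

theorem inner_map_map_of_norm_eq {K : Type*} [NormedAddCommGroup K] [InnerProductSpace ℂ K]
    (A : H →ₗ⋆[ℂ] K) {p : Submodule ℂ H} (hA : ∀ v ∈ p, ‖A v‖ = ‖v‖) {u v : H} (hu : u ∈ p)
    (hv : v ∈ p) : inner ℂ (A u) (A v) = conj (inner ℂ u v) := by
  have hsub : A u - Complex.I • A v = A (u + Complex.I • v) := by simp [sub_eq_add_neg]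
  have hadd : A u + Complex.I • A v = A (u - Complex.I • v) := by simp
  have hIv := p.smul_mem Complex.I hv
  rw [inner_eq_sum_norm_sq_div_four, inner_eq_sum_norm_sq_div_four]
  simp only [RCLike.I_to_complex, Complex.coe_algebraMap, hsub, hadd, ← map_add, ← map_sub,
    hA _ (add_mem hu hv), hA _ (sub_mem hu hv), hA _ (add_mem hu hIv), hA _ (sub_mem hu hIv)]
  simp only [map_div₀, map_add, map_sub, map_mul, map_pow, Complex.conj_I, Complex.conj_ofReal,
    map_ofNat]
  ring

theorem inner_map_map_of_antilinear (R : H →ₛₗᵢ[starRingEnd ℂ] H) (f g : H) :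
    inner ℂ (R f) (R g) = conj (inner ℂ f g) :=
  inner_map_map_of_norm_eq R.toLinearMap (p := ⊤) (fun v _ => R.norm_map v) trivial trivial

/-- A real form of the complex Hilbert space `H`, that is, a closed real subspace of which `H` is
the complexification. -/
structure IsRealForm (V : Submodule ℝ H) : Prop where
  closed : IsClosed (V : Set H)
  real_inner : ∀ u ∈ V, ∀ v ∈ V, (inner ℂ u v).im = 0
  decomp : ∀ f : H, ∃! p : V × V, (p.1 : H) + Complex.I • (p.2 : H) = f

theorem isInvariantRealForm_iff {Z : Type*} [NormedAddCommGroup Z] [InnerProductSpace ℝ Z]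
    {J : CliffordAlgebra (negNormSq Z) →ₐ[ℝ] (H →L[ℝ] H)} {V : Submodule ℝ H} :
    IsInvariantRealForm J V ↔ IsRealForm V ∧ ∀ a, ∀ v ∈ V, J a v ∈ V :=
  ⟨fun h => ⟨⟨h.closed, h.real_inner, h.decomp⟩, h.invariant⟩,
    fun h => ⟨h.1.closed, h.1.real_inner, h.1.decomp, h.2⟩⟩

/-- The real subspace of the vectors that an antilinear isometry fixes. -/
def fixedPoints (R : H →ₛₗᵢ[starRingEnd ℂ] H) : Submodule ℝ H where
  carrier := {f | R f = f}
  add_mem' {f g} hf hg := by rw [Set.mem_ofPred_eq] at *; rw [map_add, hf, hg]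
  zero_mem' := map_zero R
  smul_mem' a f hf := by
    rw [Set.mem_ofPred_eq] at *
    rw [map_real_smul R R.continuous, hf]

theorem mem_fixedPoints {R : H →ₛₗᵢ[starRingEnd ℂ] H} {f : H} :
    f ∈ fixedPoints R ↔ R f = f := Iff.rfl

theorem map_I_smul (R : H →ₛₗᵢ[starRingEnd ℂ] H) (f : H) :
    R (Complex.I • f) = -(Complex.I • R f) := by
  rw [LinearIsometry.map_smulₛₗ, Complex.conj_I, neg_smul]

theorem isRealForm_fixedPoints {R : H →ₛₗᵢ[starRingEnd ℂ] H} (hR : Function.Involutive R) :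
    IsRealForm (fixedPoints R) where
  closed := isClosed_eq R.continuous continuous_id
  real_inner u hu v hv := by
    have h := inner_map_map_of_antilinear R u v
    rw [mem_fixedPoints.1 hu, mem_fixedPoints.1 hv] at h
    exact Complex.conj_eq_iff_im.1 h.symm
  decomp f := by
    refine ⟨(⟨(2⁻¹ : ℝ) • (f + R f), ?_⟩, ⟨(2⁻¹ : ℝ) • (Complex.I • (R f - f)), ?_⟩), ?_, ?_⟩
    · rw [mem_fixedPoints, map_real_smul R R.continuous, map_add, hR, add_comm]
    · rw [mem_fixedPoints, map_real_smul R R.continuous, map_I_smul, map_sub, hR, ← smul_neg,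
        neg_sub]
    · change (2⁻¹ : ℝ) • (f + R f) + Complex.I • (2⁻¹ : ℝ) • (Complex.I • (R f - f)) = f
      rw [smul_comm Complex.I (2⁻¹ : ℝ), smul_smul Complex.I, Complex.I_mul_I]
      module
    · rintro ⟨⟨u, hu⟩, ⟨v, hv⟩⟩ rfl
      have h : R (u + Complex.I • v) = u - Complex.I • v := by
        rw [map_add, map_I_smul, mem_fixedPoints.1 hu, mem_fixedPoints.1 hv, sub_eq_add_neg]
      refine Prod.ext (Subtype.ext ?_) (Subtype.ext ?_)
      · change u = (2⁻¹ : ℝ) • (u + Complex.I • v + R (u + Complex.I • v))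
        rw [h]
        module
      · change v = (2⁻¹ : ℝ) • (Complex.I • (R (u + Complex.I • v) - (u + Complex.I • v)))
        rw [h, show u - Complex.I • v - (u + Complex.I • v) = (-2 : ℝ) • Complex.I • v by module,
          smul_comm Complex.I (-2 : ℝ), smul_smul Complex.I, Complex.I_mul_I]
        module

namespace IsRealForm

variable {V : Submodule ℝ H} (hV : IsRealForm V)

include hV

theorem exists_add_I_smul (f : H) : ∃ u ∈ V, ∃ v ∈ V, u + Complex.I • v = f := by
  obtain ⟨⟨u, v⟩, h, -⟩ := hV.decomp f
  exact ⟨u, u.2, v, v.2, h⟩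

/-- The isomorphism `V × V ≃ V ⊕ iV = H`. -/
def equivProd : (V × V) ≃ₗ[ℝ] H :=
  .ofBijective (V.subtype.coprod (Complex.I • V.subtype))
    (Function.bijective_iff_existsUnique _ |>.2 hV.decomp)

/-- The conjugation `u + iv ↦ u - iv` with respect to a real form, as a real linear map. -/
def conjₗ : H →ₗ[ℝ] H :=
  V.subtype.coprod (-(Complex.I • V.subtype)) ∘ₗ hV.equivProd.symm.toLinearMap

theorem conjₗ_add_I_smul {u v : H} (hu : u ∈ V) (hv : v ∈ V) :
    hV.conjₗ (u + Complex.I • v) = u - Complex.I • v := by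
  rw [show u + Complex.I • v = hV.equivProd (⟨u, hu⟩, ⟨v, hv⟩) from rfl, conjₗ]
  simp [sub_eq_add_neg]

theorem conjₗ_I_smul (f : H) : hV.conjₗ (Complex.I • f) = -(Complex.I • hV.conjₗ f) := by
  obtain ⟨u, hu, v, hv, rfl⟩ := hV.exists_add_I_smul f
  have h : ∀ w : H, Complex.I • Complex.I • w = -w := fun w => by
    rw [smul_smul, Complex.I_mul_I, neg_one_smul]
  rw [smul_add, h, add_comm, hV.conjₗ_add_I_smul (neg_mem hv) hu, hV.conjₗ_add_I_smul hu hv,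
    smul_sub, h]
  abel

theorem norm_conjₗ (f : H) : ‖hV.conjₗ f‖ = ‖f‖ := by
  obtain ⟨u, hu, v, hv, rfl⟩ := hV.exists_add_I_smul f
  rw [hV.conjₗ_add_I_smul hu hv, ← sq_eq_sq₀ (norm_nonneg _) (norm_nonneg _), @norm_sub_sq ℂ,
    @norm_add_sq ℂ, inner_smul_right]
  simp [hV.real_inner u hu v hv]

/-- The conjugation with respect to a real form, as an antilinear isometry. -/
def conjugation : H →ₛₗᵢ[starRingEnd ℂ] H where
  toFun := hV.conjₗ
  map_add' := map_add _
  map_smul' a f := by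
    have hsplit : ∀ (s t : ℝ) (g : H), ((s : ℂ) + t * Complex.I) • g
        = s • g + t • (Complex.I • g) := fun s t g => by
      rw [add_smul, mul_smul, Complex.coe_smul, Complex.coe_smul]
    obtain ⟨s, t⟩ := a
    rw [Complex.mk_eq_add_mul_I, hsplit, map_add, map_smul, map_smul, conjₗ_I_smul]
    simp only [map_add, map_mul, Complex.conj_ofReal, Complex.conj_I, mul_neg, ← neg_mul,
      ← Complex.ofReal_neg, hsplit, smul_neg, neg_smul]
  norm_map' := hV.norm_conjₗ

theorem conjugation_add_I_smul {u v : H} (hu : u ∈ V) (hv : v ∈ V) :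
    hV.conjugation (u + Complex.I • v) = u - Complex.I • v :=
  hV.conjₗ_add_I_smul hu hv

theorem involutive_conjugation : Function.Involutive hV.conjugation := fun f => by
  obtain ⟨u, hu, v, hv, rfl⟩ := hV.exists_add_I_smul f
  rw [hV.conjugation_add_I_smul hu hv, sub_eq_add_neg, ← smul_neg,
    hV.conjugation_add_I_smul hu (neg_mem hv), smul_neg, sub_neg_eq_add]

theorem conjugation_map_comm {G : H →ₗ[ℂ] H} (hG : ∀ v ∈ V, G v ∈ V) (f : H) :
    hV.conjugation (G f) = G (hV.conjugation f) := by
  obtain ⟨u, hu, v, hv, rfl⟩ := hV.exists_add_I_smul f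
  rw [hV.conjugation_add_I_smul hu hv, map_add, map_smul,
    hV.conjugation_add_I_smul (hG u hu) (hG v hv), map_sub, map_smul]

end IsRealForm

end RealForm

section CliffordRep

variable {ι Z H : Type*} [NormedAddCommGroup Z] [InnerProductSpace ℝ Z] [NormedAddCommGroup H]
  [InnerProductSpace ℝ H] [CompleteSpace H] (b : HilbertBasis ι ℝ Z) {S : ι → H →ₗᵢ[ℝ] H}
  (hsq : ∀ i f, S i (S i f) = -f) (hac : ∀ i j, i ≠ j → ∀ f, S i (S j f) = -S j (S i f))

theorem cliffordRep_ι (z : Z) (f : H) :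
    cliffordRep b S hsq hac (CliffordAlgebra.ι _ z) f = ∑' i, inner ℝ (b i) z • S i f := by
  rw [cliffordRep, CliffordAlgebra.lift_ι_apply, vectorOp_apply]

theorem cliffordRep_ι_basis (i : ι) (f : H) :
    cliffordRep b S hsq hac (CliffordAlgebra.ι _ (b i)) f = S i f := by
  classical
  rw [cliffordRep_ι, tsum_eq_single i]
  · rw [orthonormal_iff_ite.1 b.orthonormal, if_pos rfl, one_smul]
  · intro j hj
    rw [orthonormal_iff_ite.1 b.orthonormal, if_neg hj, zero_smul]

theorem cliffordRep_mem {V : Submodule ℝ H} (hV : IsClosed (V : Set H))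
    (h : ∀ i, ∀ v ∈ V, S i v ∈ V) (a : CliffordAlgebra (negNormSq Z)) :
    ∀ v ∈ V, cliffordRep b S hsq hac a v ∈ V := by
  induction a using CliffordAlgebra.induction with
  | algebraMap r =>
    intro v hv
    rw [AlgHom.commutes]
    exact V.smul_mem r hv
  | ι z =>
    intro v hv
    rw [cliffordRep_ι]
    exact hV.mem_of_tendsto (summable_coeff b hsq hac z v).hasSum
      (.of_forall fun s => V.sum_mem fun i _ => V.smul_mem _ (h i v hv))
  | mul a a' ha ha' =>
    intro v hv
    rw [map_mul]
    exact ha _ (ha' v hv)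
  | add a a' ha ha' =>
    intro v hv
    rw [map_add]
    exact V.add_mem (ha v hv) (ha' v hv)

end CliffordRep

namespace Triple

variable {m : ℕ∞} (T : Triple m)

section Representation

variable {Z : Type*} [NormedAddCommGroup Z] [InnerProductSpace ℝ Z]
  (b : HilbertBasis (Idx m ⊕ Idx m) ℝ Z)

theorem isInvariantRealForm_rep_iff {V : Submodule ℝ T.Space} :
    IsInvariantRealForm (T.rep b) V ↔
      IsRealForm V ∧ ∀ p, ∀ v ∈ V, T.generator p v ∈ V := by
  rw [isInvariantRealForm_iff]
  refine and_congr_right fun hV => ⟨fun h p v hv => ?_, fun h =>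
    cliffordRep_mem (H := T.Space) b T.generator_sq T.generator_anti hV.closed h⟩
  rw [← cliffordRep_ι_basis (H := T.Space) b T.generator_sq T.generator_anti]
  exact h _ v hv

theorem exists_isInvariantRealForm_iff :
    (∃ V, IsInvariantRealForm (T.rep b) V) ↔
      ∃ R : T.Space →ₛₗᵢ[starRingEnd ℂ] T.Space, Function.Involutive R ∧
        ∀ k f, R (T.opZ k f) = T.opZ k (R f) ∧ R (T.opS k f) = T.opS k (R f) := by
  simp only [isInvariantRealForm_rep_iff]
  constructor
  · rintro ⟨V, hV, hgen⟩
    exact ⟨hV.conjugation, hV.involutive_conjugation, fun k f =>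
      ⟨hV.conjugation_map_comm (G := (T.opZ k).toLinearMap) (hgen (.inl k)) f,
        hV.conjugation_map_comm (G := (T.opS k).toLinearMap) (hgen (.inr k)) f⟩⟩
  · rintro ⟨R, hR, hcomm⟩
    refine ⟨fixedPoints R, isRealForm_fixedPoints hR, ?_⟩
    rintro (k | k) f hf
    · exact ((hcomm k f).1).trans (congrArg (T.opZ k) hf)
    · exact ((hcomm k f).2).trans (congrArg (T.opS k) hf)

end Representation

end Triple

/-! ### Phases, densities and fibres -/

variable {m : ℕ∞}

section Reflection

open ComplexConjugate

theorem Occ.one_sub_eq (x : Occ m) : 1 - x = x + 1 := by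
  have h : ∀ a : ZMod 2, 1 - a = a + 1 := by decide
  exact funext fun k => h (x k)

theorem card_Iio_idx (k : Idx m) : (Finset.Iio k).card + 1 = (k : ℕ) := by
  have h : (Finset.Iio k).map (Function.Embedding.subtype _) = Finset.Ico 1 (k : ℕ) := by
    ext j
    simp only [Finset.mem_map, Finset.mem_Iio, Function.Embedding.coe_subtype, Finset.mem_Ico]
    constructor
    · rintro ⟨i, hi, rfl⟩
      exact ⟨i.2.1, hi⟩
    · rintro ⟨hj, hjk⟩
      exact ⟨⟨j, hj, (Nat.cast_le.2 hjk.le).trans k.2.2⟩, hjk, rfl⟩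
  rw [← Finset.card_map (Function.Embedding.subtype _), h, Nat.card_Ico]
  exact Nat.sub_add_cancel k.2.1

theorem conj_phaseZ_add_one (k : Idx m) (x : Occ m) :
    conj (phaseZ k (x + 1)) = (-1) ^ (k : ℕ) * phaseZ k x := by
  have h : (-1 : ℂ) ^ partialSum k (x + 1)
      = (-1) ^ (Finset.Iio k).card * (-1) ^ partialSum k x := by
    simp only [partialSum, ← Finset.prod_pow_eq_pow_sum, Pi.add_apply, Pi.one_apply, sign_add_one]
    rw [Finset.prod_neg]
  simp only [phaseZ, pow_succ, h, ← card_Iio_idx k, map_mul, map_pow, map_neg, map_one,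
    Complex.conj_I]
  ring

theorem conj_phaseS_add_one (k : Idx m) (x : Occ m) :
    conj (phaseS k (x + 1)) = (-1) ^ (k : ℕ) * phaseS k x := by
  rw [phaseS, phaseS, map_mul, conj_phaseZ_add_one, Pi.add_apply, Pi.one_apply, sign_add_one]
  simp only [map_mul, map_pow, map_neg, map_one, Complex.conj_I]
  ring

end Reflection

section Density

namespace Triple

variable (T : Triple m) {δ δ' : Occ m}

theorem density_mul_translate (hδ : Measure.QuasiMeasurePreserving (· + δ) T.μ T.μ)
    (hδ' : Measure.QuasiMeasurePreserving (· + δ') T.μ T.μ) :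
    ∀ᵐ x ∂T.μ, T.density δ x * T.density δ' (x + δ) = T.density (δ + δ') x := by
  have hmap : (T.μ.map (· + δ')).map (· + δ) = T.μ.map (· + (δ + δ')) := by
    rw [Measure.map_map hδ.measurable hδ'.measurable]
    congr 1
    ext x
    simp [add_assoc, add_comm δ]
  have hchain := Measure.rnDeriv_mul_rnDeriv (κ := T.μ) (μ := T.μ.map (· + (δ + δ')))
    (ν := T.μ.map (· + δ)) (by rw [← hmap]; exact hδ'.absolutelyContinuous.map hδ.measurable)
  have htranslate := hδ.ae
    ((translate δ).measurableEmbedding.rnDeriv_map (T.μ.map (· + δ')) T.μ)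
  filter_upwards [hchain, htranslate] with x hx hxδ
  change ((T.μ.map (· + δ')).map (· + δ)).rnDeriv (T.μ.map (· + δ)) (x + δ + δ) = _ at hxδ
  rw [hmap, Occ.add_add_cancel] at hxδ
  rw [density, density, density, ← hx, Pi.mul_apply, mul_comm, ← hxδ]

theorem density_zero : ∀ᵐ x ∂T.μ, T.density 0 x = 1 := by
  filter_upwards [T.μ.rnDeriv_self] with x hx
  simpa [density] using hx

theorem density_mul_translate_self (hδ : Measure.QuasiMeasurePreserving (· + δ) T.μ T.μ) :
    ∀ᵐ x ∂T.μ, T.density δ x * T.density δ (x + δ) = 1 := by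
  filter_upwards [T.density_mul_translate hδ hδ, T.density_zero] with x hx h0
  rw [hx, Occ.add_self, h0]

theorem density_toReal_pos (hδ : Measure.QuasiMeasurePreserving (· + δ) T.μ T.μ) :
    ∀ᵐ x ∂T.μ, 0 < (T.density δ x).toReal := by
  filter_upwards [T.density_mul_translate_self hδ, Measure.rnDeriv_lt_top (T.μ.map (· + δ)) T.μ]
    with x hx hlt
  exact ENNReal.toReal_pos (left_ne_zero_of_mul_eq_one hx) hlt.ne

theorem lintegral_density_mul (hδ : Measure.QuasiMeasurePreserving (· + δ) T.μ T.μ)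
    {g : Occ m → ℝ≥0∞} (hg : AEMeasurable g T.μ) :
    ∫⁻ x, T.density δ x * g (x + δ) ∂T.μ = ∫⁻ x, g x ∂T.μ := calc
  _ = ∫⁻ x, g (x + δ) ∂(T.μ.map (· + δ)) :=
    lintegral_rnDeriv_mul hδ.absolutelyContinuous (hg.comp_quasiMeasurePreserving hδ)
  _ = ∫⁻ x, g (x + δ + δ) ∂T.μ := lintegral_map_equiv _ (translate δ)
  _ = _ := by simp only [Occ.add_add_cancel]

end Triple

end Density

section Fiber

/-- The standard orthonormal basis of the fibre `H_n`, continued by `0` from the `n`-th vector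
on. -/
def fiberBasis (n : ℕ∞) (i : ℕ) : Ell2 := if (i : ℕ∞) < n then lp.single 2 i (1 : ℂ) else 0

variable {n : ℕ∞}

theorem fiberBasis_apply (i j : ℕ) :
    fiberBasis n i j = if i = j ∧ (i : ℕ∞) < n then 1 else 0 := by
  rw [fiberBasis]
  by_cases hi : (i : ℕ∞) < n
  · simp [hi, lp.single_apply, Pi.single_apply, eq_comm]
  · simp [hi]

theorem fiberBasis_mem (i : ℕ) : fiberBasis n i ∈ fiber n := fun j hj => by
  rw [fiberBasis_apply, if_neg]
  rintro ⟨rfl, hi⟩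
  exact hi.not_ge hj

theorem norm_fiberBasis_le (i : ℕ) : ‖fiberBasis n i‖ ≤ 1 := by
  rw [fiberBasis]
  split_ifs
  · simp [lp.norm_single]
  · simp

theorem inner_fiberBasis {v : Ell2} (hv : v ∈ fiber n) (i : ℕ) :
    inner ℂ (fiberBasis n i) v = v i := by
  rw [fiberBasis]
  split_ifs with hi
  · simp [lp.inner_single_left]
  · rw [inner_zero_left, hv i (not_lt.1 hi)]

theorem hasSum_fiberBasis {v : Ell2} (hv : v ∈ fiber n) :
    HasSum (fun i => v i • fiberBasis n i) v := by
  refine (lp.hasSum_single ENNReal.ofNat_ne_top v).congr_fun fun i => ?_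
  rw [fiberBasis]
  split_ifs with hi
  · rw [← lp.single_smul, smul_eq_mul, mul_one]
  · rw [hv i (not_lt.1 hi)]
    simp

theorem eq_on_fiber {σ : ℂ →+* ℂ} {A B : Ell2 →SL[σ] Ell2}
    (h : ∀ i, A (fiberBasis n i) = B (fiberBasis n i)) {v : Ell2} (hv : v ∈ fiber n) :
    A v = B v := by
  refine ((hasSum_fiberBasis hv).mapL A).unique ?_
  refine ((hasSum_fiberBasis hv).mapL B).congr_fun fun i => ?_
  rw [ContinuousLinearMap.map_smulₛₗ, ContinuousLinearMap.map_smulₛₗ, h i]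

theorem le_of_linearIndependent_fiber {a d : ℕ} {u : Fin a → fiber d}
    (hu : LinearIndependent ℂ u) : a ≤ d := by
  let coords : fiber d →ₗ[ℂ] (Fin d → ℂ) :=
    { toFun := fun v i => (v : Ell2) i
      map_add' := fun _ _ => rfl
      map_smul' := fun _ _ => rfl }
  have hker : LinearMap.ker coords = ⊥ := by
    refine LinearMap.ker_eq_bot'.2 fun v hv => Subtype.ext (lp.ext (funext fun i => ?_))
    by_cases hi : i < d
    · exact congrFun hv ⟨i, hi⟩
    · exact v.2 i (Nat.cast_le.2 (not_lt.1 hi))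
  simpa using (hu.map' coords hker).fintype_card_le_finrank

/-- An orthonormal sequence of `n` vectors, continued by `0` from the `n`-th vector on, like
`fiberBasis n`. -/
def OrthonormalBelow (n : ℕ∞) (u : ℕ → Ell2) : Prop :=
  ∀ i j : ℕ, inner ℂ (u i) (u j) = if i = j ∧ (i : ℕ∞) < n then (1 : ℂ) else 0

theorem orthonormalBelow_fiberBasis : OrthonormalBelow n (fiberBasis n) := fun i j => by
  rw [inner_fiberBasis (fiberBasis_mem j), fiberBasis_apply]
  exact if_congr (by grind) rfl rfl

theorem OrthonormalBelow.le_of_mem_fiber {d : ℕ∞} {u : ℕ → Ell2} (hu : OrthonormalBelow n u)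
    (hmem : ∀ i, u i ∈ fiber d) : n ≤ d := by
  refine ENat.forall_natCast_le_iff_le.1 fun a ha => ?_
  induction d with
  | top => exact le_top
  | coe d =>
    have hlt : ∀ i : Fin a, ((i : ℕ) : ℕ∞) < n := fun i => (Nat.cast_lt.2 i.2).trans_le ha
    have ho : Orthonormal ℂ fun i : Fin a => u i :=
      orthonormal_iff_ite.2 fun i j => by simp [hu (i : ℕ), hlt, Fin.ext_iff]
    exact Nat.cast_le.2 (le_of_linearIndependent_fiber
      (u := fun i : Fin a => ⟨u i, hmem i⟩) (.of_comp (fiber d).subtype ho.linearIndependent))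

theorem stronglyMeasurable_apply_of_semilinear {α : Type*} [MeasurableSpace α] {σ : ℂ →+* ℂ}
    [RingHomIsometric σ] {A : α → (Ell2 →SL[σ] Ell2)}
    (hA : ∀ v, StronglyMeasurable fun x => A x v) {f : α → Ell2} (hf : StronglyMeasurable f) :
    StronglyMeasurable fun x => A x (f x) := by
  have hσ : Continuous σ := (AddMonoidHomClass.isometry_of_norm σ fun _ =>
    RingHomIsometric.norm_map).continuous
  have hcoord : ∀ i, Measurable fun x => f x i := fun i =>
    ((lp.evalCLM ℂ (fun _ : ℕ => ℂ) 2 i).continuous.comp_stronglyMeasurable hf).measurable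
  refine stronglyMeasurable_of_tendsto Filter.atTop (f := fun N x =>
    ∑ i ∈ Finset.range N, σ (f x i) • A x (fiberBasis ⊤ i)) (fun N => ?_) ?_
  · exact Finset.stronglyMeasurable_fun_sum _ fun i _ =>
      (hσ.measurable.comp (hcoord i)).stronglyMeasurable.smul (hA _)
  · refine tendsto_pi_nhds.2 fun x => ?_
    have hmem : f x ∈ fiber ⊤ := fun i hi => absurd hi (ENat.natCast_ne_top i).lt_top.not_ge
    simpa using ((hasSum_fiberBasis hmem).mapL (A x)).tendsto_sum_nat

end Fiber

/-! ### Weighted shifts of the direct integral -/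

theorem exists_memLp_pos {α : Type*} [MeasurableSpace α] (μ : Measure α) [SigmaFinite μ] :
    ∃ w : α → ℝ, Measurable w ∧ (∀ x, 0 < w x) ∧ MemLp w 2 μ := by
  obtain ⟨g, hpos, hg, hlt⟩ := exists_pos_lintegral_lt_of_sigmaFinite μ one_ne_zero
  have hw : Measurable fun x => √(g x) := by fun_prop
  refine ⟨fun x => √(g x), hw, fun x => Real.sqrt_pos.2 (hpos x), hw.aestronglyMeasurable, ?_⟩
  rw [eLpNorm_lt_top_iff_lintegral_rpow_enorm_lt_top two_ne_zero ENNReal.ofNat_ne_top]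
  refine lt_of_eq_of_lt (lintegral_congr fun x => ?_) (hlt.trans ENNReal.one_lt_top)
  rw [ENNReal.toReal_ofNat, ENNReal.rpow_ofNat, Real.enorm_of_nonneg (Real.sqrt_nonneg _),
    ← ENNReal.ofReal_pow (Real.sqrt_nonneg _), Real.sq_sqrt (g x).coe_nonneg,
    ENNReal.ofReal_coe_nnreal]

namespace Triple

variable (T : Triple m)

section Field

variable {T}

theorem space_ext {f g : T.Space} (h : f.1 =ᵐ[T.μ] g.1) : f = g := Subtype.ext (Lp.ext h)

theorem space_ext_iff {f g : T.Space} : f = g ↔ f.1 =ᵐ[T.μ] g.1 :=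
  ⟨fun h => by rw [h], space_ext⟩

/-- The element of the direct integral `∫⊕ H_x dμ(x)` represented by a square integrable
function. -/
def ofMemLp {f : Occ m → Ell2} (hf : MemLp f 2 T.μ) (hmem : ∀ᵐ x ∂T.μ, f x ∈ fiber (T.ν x)) :
    T.Space :=
  ⟨hf.toLp f, by
    filter_upwards [hf.coeFn_toLp, hmem] with x hx hmem
    rwa [hx]⟩

theorem coeFn_ofMemLp {f : Occ m → Ell2} (hf : MemLp f 2 T.μ)
    (hmem : ∀ᵐ x ∂T.μ, f x ∈ fiber (T.ν x)) : (ofMemLp hf hmem).1 =ᵐ[T.μ] f :=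
  hf.coeFn_toLp

theorem inner_eq_integral (f g : T.Space) :
    inner ℂ f g = ∫ x, inner ℂ (f.1 x) (g.1 x) ∂T.μ :=
  L2.inner_def f.1 g.1

end Field

section Frame

/-- A sequence of elements of the direct integral that are multiples of the standard orthonormal
bases of the fibres, with a common positive weight `w`. -/
structure IsFrame (w : Occ m → ℝ) (s : ℕ → T.Space) : Prop where
  measurable : Measurable w
  pos : ∀ x, 0 < w x
  coeFn : ∀ i, (s i).1 =ᵐ[T.μ] fun x => w x • fiberBasis (T.ν x) i

theorem stronglyMeasurable_fiberBasis (i : ℕ) :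
    StronglyMeasurable fun x => fiberBasis (T.ν x) i :=
  stronglyMeasurable_const.ite (T.measurable_ν (MeasurableSet.of_discrete (s := Set.Ioi (i : ℕ∞))))
    stronglyMeasurable_const

theorem exists_isFrame : ∃ w s, T.IsFrame w s := by
  obtain ⟨w, hw, hpos, hL⟩ := exists_memLp_pos T.μ
  have hs : ∀ i, MemLp (fun x => w x • fiberBasis (T.ν x) i) 2 T.μ := fun i => by
    refine hL.of_le
      (hw.stronglyMeasurable.smul (T.stronglyMeasurable_fiberBasis i)).aestronglyMeasurable
      (.of_forall fun x => ?_)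
    rw [norm_smul]
    exact mul_le_of_le_one_right (norm_nonneg _) (norm_fiberBasis_le i)
  exact ⟨w, fun i => ofMemLp (hs i) (.of_forall fun x =>
    (fiber _).smul_of_tower_mem (w x) (fiberBasis_mem i)), hw, hpos, fun i => coeFn_ofMemLp _ _⟩

variable {T} {w : Occ m → ℝ} {s : ℕ → T.Space}

theorem IsFrame.eq_zero_of_inner_eq_zero (hs : T.IsFrame w s) {g : T.Space}
    (hg : ∀ i, ∀ᵐ x ∂T.μ, inner ℂ ((s i).1 x) (g.1 x) = 0) : g = 0 := by
  refine space_ext (.trans ?_ (Lp.coeFn_zero Ell2 2 T.μ).symm)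
  filter_upwards [ae_all_iff.2 hg, ae_all_iff.2 hs.coeFn, g.2] with x hg hs' hmem
  refine lp.ext (funext fun i => ?_)
  have h := hg i
  rw [hs' i, inner_smul_left_eq_star_smul, inner_fiberBasis hmem] at h
  simpa [(hs.pos x).ne'] using h

end Frame

section WeightedShift

variable {σ τ ρ : ℂ →+* ℂ} {δ δ' : Occ m}

/-- The weighted shift `f ↦ √(dμ(x + δ)/dμ(x)) A(x) f(x + δ)` with operator coefficients. The
generators of the Gårding–Wightman representation are weighted shifts by `δ_k`. -/
def weightedShift (δ : Occ m) (A : Occ m → (Ell2 →SL[σ] Ell2)) (f : Occ m → Ell2) (x : Occ m) :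
    Ell2 :=
  √(T.density δ x).toReal • A x (f (x + δ))

theorem opFun_eq_weightedShift (a : Occ m → ℂ) (k : Idx m) :
    T.opFun a k = T.weightedShift (delta k) fun x => a x • T.c k x := by
  funext f x
  rw [opFun, weightedShift, mul_comm, mul_smul, Complex.coe_smul]
  rfl

variable {T}

theorem weightedShift_congr (hδ : Measure.QuasiMeasurePreserving (· + δ) T.μ T.μ)
    (A : Occ m → (Ell2 →SL[σ] Ell2)) {f g : Occ m → Ell2} (hfg : f =ᵐ[T.μ] g) :
    T.weightedShift δ A f =ᵐ[T.μ] T.weightedShift δ A g := by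
  filter_upwards [hδ.ae hfg] with x hx
  rw [weightedShift, weightedShift, hx]

theorem weightedShift_weightedShift [RingHomCompTriple σ τ ρ]
    (hδ : Measure.QuasiMeasurePreserving (· + δ) T.μ T.μ)
    (hδ' : Measure.QuasiMeasurePreserving (· + δ') T.μ T.μ)
    (A : Occ m → (Ell2 →SL[τ] Ell2)) (B : Occ m → (Ell2 →SL[σ] Ell2)) (f : Occ m → Ell2) :
    T.weightedShift δ A (T.weightedShift δ' B f) =ᵐ[T.μ]
      T.weightedShift (δ + δ') (fun x => (A x).comp (B (x + δ))) f := by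
  filter_upwards [T.density_mul_translate hδ hδ'] with x hx
  rw [weightedShift, weightedShift, weightedShift, ← hx,
    map_real_smul (A x) (A x).continuous, smul_smul, ENNReal.toReal_mul,
    Real.sqrt_mul ENNReal.toReal_nonneg, ContinuousLinearMap.comp_apply, add_assoc]

/-- The operator `P` of the direct integral is the weighted shift by `δ` with coefficients `A`. -/
def IsWeightedShift (P : T.Space → T.Space) (δ : Occ m) (A : Occ m → (Ell2 →SL[σ] Ell2)) : Prop :=
  ∀ f, (P f).1 =ᵐ[T.μ] T.weightedShift δ A f.1

theorem isWeightedShift_op {a : Occ m → ℂ} (ha : Measurable a) (ha' : ∀ x, ‖a x‖ = 1)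
    (k : Idx m) : IsWeightedShift (T.op a ha ha' k) (delta k) fun x => a x • T.c k x := by
  intro f
  rw [← opFun_eq_weightedShift]
  exact T.op_apply a ha ha' k f

theorem isWeightedShift_id : IsWeightedShift (T := T) id 0 fun _ => .id ℂ Ell2 := by
  intro f
  filter_upwards [T.density_zero] with x hx
  simp [weightedShift, hx]

namespace IsWeightedShift

variable {P Q : T.Space → T.Space} {A B : Occ m → (Ell2 →SL[σ] Ell2)}

theorem comp [RingHomCompTriple σ τ ρ] {A : Occ m → (Ell2 →SL[τ] Ell2)}
    (hP : IsWeightedShift P δ A) (hQ : IsWeightedShift Q δ' B)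
    (hδ : Measure.QuasiMeasurePreserving (· + δ) T.μ T.μ)
    (hδ' : Measure.QuasiMeasurePreserving (· + δ') T.μ T.μ) :
    IsWeightedShift (P ∘ Q) (δ + δ') fun x => (A x).comp (B (x + δ)) := fun f =>
  ((hP (Q f)).trans (weightedShift_congr hδ A (hQ f))).trans
    (weightedShift_weightedShift hδ hδ' A B f.1)

theorem eq_iff (hP : IsWeightedShift P δ A) (hQ : IsWeightedShift Q δ B)
    (hδ : Measure.QuasiMeasurePreserving (· + δ) T.μ T.μ) :
    P = Q ↔ ∀ᵐ x ∂T.μ, ∀ v ∈ fiber (T.ν (x + δ)), A x v = B x v := by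
  constructor
  · rintro rfl
    obtain ⟨w, s, hs⟩ := T.exists_isFrame
    filter_upwards [ae_all_iff.2 fun i => (hP (s i)).symm.trans (hQ (s i)),
      ae_all_iff.2 fun i => hδ.ae (hs.coeFn i), T.density_toReal_pos hδ] with x hPQ hsx hpos v hv
    refine eq_on_fiber (fun i => ?_) hv
    have h := hPQ i
    rw [weightedShift, weightedShift, hsx i] at h
    rw [map_real_smul (A x) (A x).continuous, map_real_smul (B x) (B x).continuous] at h
    exact smul_right_injective _ (hs.pos (x + δ)).ne'
      (smul_right_injective _ (Real.sqrt_pos.2 hpos).ne' h)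
  · intro h
    refine funext fun f => space_ext ((hP f).trans (.trans ?_ (hQ f).symm))
    filter_upwards [h, hδ.ae f.2] with x hx hf
    rw [weightedShift, weightedShift, hx _ hf]

end IsWeightedShift

end WeightedShift

end Triple

namespace Triple

variable (T : Triple m)

section IsometricField

variable {σ : ℂ →+* ℂ} {δ : Occ m} {A : Occ m → (Ell2 →SL[σ] Ell2)}

/-- A measurable field of semilinear isometries `A(x) : H_{x + δ} → H_x`, where `H_{x + δ} = H_x`
almost everywhere, over a measure that is quasi-invariant under translation by `δ`. -/
structure IsIsometricField (δ : Occ m) (A : Occ m → (Ell2 →SL[σ] Ell2)) : Prop where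
  quasiMeasurePreserving : Measure.QuasiMeasurePreserving (· + δ) T.μ T.μ
  ν_add : ∀ᵐ x ∂T.μ, T.ν (x + δ) = T.ν x
  stronglyMeasurable : ∀ v, StronglyMeasurable fun x => A x v
  mem_fiber : ∀ᵐ x ∂T.μ, ∀ v ∈ fiber (T.ν x), A x v ∈ fiber (T.ν x)
  norm_map : ∀ᵐ x ∂T.μ, ∀ v ∈ fiber (T.ν x), ‖A x v‖ = ‖v‖

namespace IsIsometricField

variable {T}

theorem translate_mem_fiber (hA : T.IsIsometricField δ A) (f : T.Space) :
    ∀ᵐ x ∂T.μ, f.1 (x + δ) ∈ fiber (T.ν x) := by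
  filter_upwards [hA.quasiMeasurePreserving.ae f.2, hA.ν_add] with x hx hν
  rwa [hν] at hx

theorem weightedShift_mem_fiber (hA : T.IsIsometricField δ A) (f : T.Space) :
    ∀ᵐ x ∂T.μ, T.weightedShift δ A f.1 x ∈ fiber (T.ν x) := by
  filter_upwards [hA.translate_mem_fiber f, hA.mem_fiber] with x hf hmem
  exact (fiber _).smul_of_tower_mem _ (hmem _ hf)

theorem aestronglyMeasurable_weightedShift [RingHomIsometric σ] (hA : T.IsIsometricField δ A)
    {f : Occ m → Ell2} (hf : AEStronglyMeasurable f T.μ) :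
    AEStronglyMeasurable (T.weightedShift δ A f) T.μ := by
  obtain ⟨g, hg, hfg⟩ := hf
  have hd : Measurable fun x => √(T.density δ x).toReal :=
    (Measure.measurable_rnDeriv _ _).ennreal_toReal.sqrt
  exact ⟨T.weightedShift δ A g, hd.stronglyMeasurable.smul
    (stronglyMeasurable_apply_of_semilinear hA.stronglyMeasurable
      (hg.comp_measurable (measurable_add_const δ))),
    weightedShift_congr hA.quasiMeasurePreserving A hfg⟩

theorem eLpNorm_weightedShift (hA : T.IsIsometricField δ A) (f : T.Space) :
    eLpNorm (T.weightedShift δ A f.1) 2 T.μ = eLpNorm f.1 2 T.μ := by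
  rw [eLpNorm_eq_lintegral_rpow_enorm_toReal two_ne_zero ENNReal.ofNat_ne_top,
    eLpNorm_eq_lintegral_rpow_enorm_toReal two_ne_zero ENNReal.ofNat_ne_top]
  simp only [ENNReal.toReal_ofNat, ENNReal.rpow_ofNat]
  congr 1
  rw [← T.lintegral_density_mul hA.quasiMeasurePreserving
    ((Lp.aestronglyMeasurable f.1).enorm.pow_const _)]
  refine lintegral_congr_ae ?_
  filter_upwards [hA.translate_mem_fiber f, hA.norm_map,
    Measure.rnDeriv_lt_top (T.μ.map (· + δ)) T.μ] with x hf hnorm hlt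
  rw [weightedShift, enorm_smul, mul_pow, ← ofReal_norm (A x _), hnorm _ hf, ofReal_norm,
    Real.enorm_of_nonneg (Real.sqrt_nonneg _), ← ENNReal.ofReal_pow (Real.sqrt_nonneg _),
    Real.sq_sqrt ENNReal.toReal_nonneg, density, ENNReal.ofReal_toReal hlt.ne]

variable [RingHomIsometric σ]

theorem memLp_weightedShift (hA : T.IsIsometricField δ A) (f : T.Space) :
    MemLp (T.weightedShift δ A f.1) 2 T.μ :=
  ⟨hA.aestronglyMeasurable_weightedShift (Lp.aestronglyMeasurable f.1),
    (hA.eLpNorm_weightedShift f).trans_lt (Lp.eLpNorm_lt_top f.1)⟩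

theorem coeFn_ofMemLp_weightedShift (hA : T.IsIsometricField δ A) :
    IsWeightedShift (fun f => ofMemLp (hA.memLp_weightedShift f) (hA.weightedShift_mem_fiber f))
      δ A :=
  fun _ => coeFn_ofMemLp _ _

/-- The weighted shift with isometric coefficients, as a semilinear isometry of the direct
integral. -/
def shift (hA : T.IsIsometricField δ A) : T.Space →ₛₗᵢ[σ] T.Space where
  toFun f := ofMemLp (hA.memLp_weightedShift f) (hA.weightedShift_mem_fiber f)
  map_add' f g := space_ext (by
    refine .trans ?_ (Lp.coeFn_add _ _).symm
    filter_upwards [hA.quasiMeasurePreserving.ae (Lp.coeFn_add f.1 g.1),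
      hA.coeFn_ofMemLp_weightedShift (f + g), hA.coeFn_ofMemLp_weightedShift f,
      hA.coeFn_ofMemLp_weightedShift g] with x hadd hfg hf hg
    rw [hfg, Pi.add_apply, hf, hg, weightedShift]
    change _ • A x ((f.1 + g.1 : Lp Ell2 2 T.μ) (x + δ)) = _
    rw [hadd, Pi.add_apply, map_add, smul_add, weightedShift, weightedShift])
  map_smul' a f := space_ext (by
    refine .trans ?_ (Lp.coeFn_smul _ _).symm
    filter_upwards [hA.quasiMeasurePreserving.ae (Lp.coeFn_smul a f.1),
      hA.coeFn_ofMemLp_weightedShift (a • f), hA.coeFn_ofMemLp_weightedShift f]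
      with x hsmul haf hf
    rw [haf, Pi.smul_apply, hf, weightedShift]
    change _ • A x ((a • f.1 : Lp Ell2 2 T.μ) (x + δ)) = _
    rw [hsmul, Pi.smul_apply, ContinuousLinearMap.map_smulₛₗ, smul_comm, weightedShift])
  norm_map' f := by
    change ‖(hA.memLp_weightedShift f).toLp _‖ = ‖f.1‖
    rw [Lp.norm_toLp, hA.eLpNorm_weightedShift f, Lp.norm_def]

theorem isWeightedShift_shift (hA : T.IsIsometricField δ A) : IsWeightedShift hA.shift δ A :=
  hA.coeFn_ofMemLp_weightedShift

end IsIsometricField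

end IsometricField

section Dictionary

open ComplexConjugate

variable {T} {r : Occ m → (Ell2 →L⋆[ℂ] Ell2)} {R : T.Space → T.Space}

theorem IsWeightedShift.involutive_iff (hr : T.IsIsometricField 1 r)
    (hR : IsWeightedShift R 1 r) :
    Function.Involutive R ↔ ∀ᵐ x ∂T.μ, ∀ v ∈ fiber (T.ν x), r x (r (x + 1) v) = v := by
  have hq := hr.quasiMeasurePreserving
  have h0 : Measure.QuasiMeasurePreserving (· + (0 : Occ m)) T.μ T.μ := by
    simpa using! Measure.QuasiMeasurePreserving.id T.μ
  have hRR : IsWeightedShift (R ∘ R) 0 fun x => (r x).comp (r (x + 1)) := by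
    simpa only [Occ.add_self] using hR.comp hR hq hq
  rw [Function.involutive_iff_iter_2_eq_id, Function.iterate_succ, Function.iterate_one,
    hRR.eq_iff isWeightedShift_id h0]
  simp only [add_zero, ContinuousLinearMap.comp_apply, ContinuousLinearMap.id_apply]

theorem IsWeightedShift.commute_op_iff (hr : T.IsIsometricField 1 r) (hR : IsWeightedShift R 1 r)
    {a : Occ m → ℂ} (ha : Measurable a) (ha' : ∀ x, ‖a x‖ = 1) {k : Idx m}
    (hconj : ∀ x, conj (a (x + 1)) = (-1) ^ (k : ℕ) * a x) :
    (∀ f, R (T.op a ha ha' k f) = T.op a ha ha' k (R f)) ↔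
      ∀ᵐ x ∂T.μ, ∀ v ∈ fiber (T.ν x),
        r x (T.c k (x + 1) v) = (-1 : ℂ) ^ (k : ℕ) • T.c k x (r (x + delta k) v) := by
  have hq := hr.quasiMeasurePreserving
  have hk := T.quasiMeasurePreserving (delta_mem k)
  have hop := isWeightedShift_op (T := T) ha ha' k
  have hRop := hR.comp hop hq hk
  have hopR := hop.comp hR hk hq
  rw [add_comm] at hopR
  have hqk : Measure.QuasiMeasurePreserving (· + (1 + delta k)) T.μ T.μ := by
    simpa only [Function.comp_def, add_assoc] using hk.comp hq
  have hν : ∀ᵐ x ∂T.μ, T.ν (x + (1 + delta k)) = T.ν x := by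
    filter_upwards [hq.ae (T.ν_invariant _ (delta_mem k)), hr.ν_add] with x hxk hx
    rw [← add_assoc, hxk, hx]
  refine (funext_iff.symm.trans (hRop.eq_iff hopR hqk)).trans (Filter.eventually_congr ?_)
  filter_upwards [hν] with x hx
  rw [hx]
  refine forall₂_congr fun v _ => ?_
  have hax : a x ≠ 0 := norm_ne_zero_iff.1 (by simp [ha'])
  have hsign : (-1 : ℂ) ^ (k : ℕ) * (-1) ^ (k : ℕ) = 1 := by rw [← mul_pow]; simp
  simp only [ContinuousLinearMap.comp_apply, smul_apply,
    ContinuousLinearMap.map_smulₛₗ, hconj, mul_comm _ (a x), mul_smul]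
  rw [(smul_right_injective Ell2 hax).eq_iff]
  constructor
  · intro h
    rw [← h, smul_smul, hsign, one_smul]
  · intro h
    rw [h, smul_smul, hsign, one_smul]

end Dictionary

end Triple

/-! ### Antiunitary involutions and reflection of supports -/

namespace Triple

open ComplexConjugate

variable {T : Triple m}

theorem opS_opZ_apply (k : Idx m) (f : T.Space) :
    ∀ᵐ x ∂T.μ, (T.opS k (T.opZ k f)).1 x = -((-1) ^ (x k).val * Complex.I) • f.1 x := by
  have hZZ : (T.opZ k (T.opZ k f)).1 =ᵐ[T.μ] -f.1 := by
    rw [show T.opZ k (T.opZ k f) = -f from T.generator_sq (.inl k) f]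
    exact Lp.coeFn_neg f.1
  filter_upwards [T.op_apply (phaseS k) (measurable_phaseS k) (norm_phaseS k) k (T.opZ k f),
    T.op_apply (phaseZ k) (measurable_phaseZ k) (norm_phaseZ k) k (T.opZ k f), hZZ]
    with x hS hZ hneg
  have hshift : T.opFun (phaseZ k) k (T.opZ k f).1 x = -f.1 x := hZ.symm.trans hneg
  refine hS.trans ?_
  rw [neg_smul, ← smul_neg, ← hshift, opFun, opFun, phaseS, smul_smul]
  congr 1
  ring

section Cut

/-- The restriction of an element of the direct integral to a measurable set, extended by zero. -/
def cut {E : Set (Occ m)} (hE : MeasurableSet E) (f : T.Space) : T.Space :=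
  ofMemLp ((Lp.memLp f.1).indicator hE) (by
    filter_upwards [f.2] with x hx
    by_cases hxE : x ∈ E <;> simp [hxE, hx, zero_mem])

/-- The element `f` of the direct integral is zero almost everywhere on `E`. -/
def VanishesOn (f : T.Space) (E : Set (Occ m)) : Prop := ∀ᵐ x ∂T.μ, x ∈ E → f.1 x = 0

variable {E : Set (Occ m)} (hE : MeasurableSet E)

theorem coeFn_cut (f : T.Space) : (cut hE f).1 =ᵐ[T.μ] E.indicator f.1 :=
  coeFn_ofMemLp _ _

theorem inner_cut_left (f g : T.Space) :
    inner ℂ (cut hE f) g = ∫ x in E, inner ℂ (f.1 x) (g.1 x) ∂T.μ := by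
  rw [inner_eq_integral, ← integral_indicator hE]
  refine integral_congr_ae ?_
  filter_upwards [coeFn_cut hE f] with x hx
  rw [hx]
  by_cases h : x ∈ E <;> simp [h]

theorem cut_add_cut_compl (f : T.Space) : cut hE f + cut hE.compl f = f := by
  refine space_ext ((Lp.coeFn_add _ _).trans ?_)
  filter_upwards [coeFn_cut hE f, coeFn_cut hE.compl f] with x hx hx'
  rw [Pi.add_apply, hx, hx', Set.indicator_self_add_compl_apply]

theorem vanishesOn_cut_compl (f : T.Space) : VanishesOn (cut hE f) Eᶜ := by
  filter_upwards [coeFn_cut hE f] with x hx hxE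
  rw [hx, Set.indicator_of_notMem hxE]

theorem inner_cut_self (f : T.Space) : inner ℂ (cut hE f) f = inner ℂ (cut hE f) (cut hE f) := by
  rw [inner_cut_left, inner_cut_left]
  refine setIntegral_congr_ae hE ?_
  filter_upwards [coeFn_cut hE f] with x hx hxE
  rw [hx, Set.indicator_of_mem hxE]

theorem vanishesOn_iff_cut_eq_zero (f : T.Space) : VanishesOn f E ↔ cut hE f = 0 := by
  refine .trans (Filter.eventually_congr ?_) space_ext_iff.symm
  filter_upwards [coeFn_cut hE f, Lp.coeFn_zero Ell2 2 T.μ] with x hx h0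
  change _ ↔ _ = (0 : Lp Ell2 2 T.μ) x
  rw [hx, h0, Pi.zero_apply, Set.indicator_apply_eq_zero]

include hE in
theorem vanishesOn_compl_iff (f : T.Space) :
    VanishesOn f Eᶜ ↔ ∀ g, VanishesOn g E → inner ℂ f g = 0 := by
  constructor
  · intro hf g hg
    rw [inner_eq_integral]
    refine integral_eq_zero_of_ae ?_
    filter_upwards [hf, hg] with x hfx hgx
    by_cases hx : x ∈ E
    · simp [hgx hx]
    · simp [hfx hx]
  · intro h
    have hcut : VanishesOn (cut hE.compl f) E := by
      simpa only [compl_compl] using vanishesOn_cut_compl hE.compl f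
    rw [vanishesOn_iff_cut_eq_zero hE.compl, ← inner_self_eq_zero (𝕜 := ℂ), ← inner_cut_self,
      ← inner_conj_symm, h _ hcut, map_zero]

theorem vanishesOn_iUnion {f : T.Space} {E : ℕ → Set (Occ m)} :
    VanishesOn f (⋃ n, E n) ↔ ∀ n, VanishesOn f (E n) := by
  simp only [VanishesOn, ← ae_all_iff, Set.mem_iUnion, forall_exists_index]

theorem vanishesOn_coordinate_iff (f : T.Space) (k : Idx m) (a : ZMod 2) :
    VanishesOn f {x | x k = a} ↔ T.opS k (T.opZ k f) = ((-1 : ℂ) ^ a.val * Complex.I) • f := by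
  have hsign : ∀ b : ZMod 2, b ≠ a → (-1 : ℂ) ^ b.val = -(-1) ^ a.val := fun b hb => by
    rw [show b = a + 1 by revert a b; decide, sign_add_one]
  refine .trans (Filter.eventually_congr ?_) space_ext_iff.symm
  filter_upwards [opS_opZ_apply k f, Lp.coeFn_smul ((-1 : ℂ) ^ a.val * Complex.I) f.1]
    with x hx hsmul
  change _ ↔ _ = ((((-1 : ℂ) ^ a.val * Complex.I) • f.1 : Lp Ell2 2 T.μ)) x
  rw [hx, hsmul, Pi.smul_apply]
  by_cases hxk : x k = a
  · rw [hxk, neg_smul, neg_eq_iff_add_eq_zero, ← two_smul ℂ]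
    simp
  · simp [hxk, hsign _ hxk]

end Cut

section Reflection

/-- The reflection `1 - E = E + 1` of a set of occupation numbers. -/
abbrev reflSet (E : Set (Occ m)) : Set (Occ m) := (· + 1) ⁻¹' E

theorem measurableSet_reflSet {E : Set (Occ m)} (hE : MeasurableSet E) :
    MeasurableSet (reflSet E) := measurable_add_const 1 hE

theorem reflSet_reflSet (E : Set (Occ m)) : reflSet (reflSet E) = E := by
  ext x
  simp [Occ.add_add_cancel]

/-- The operator `R` carries the elements that vanish on `E` to those that vanish on `1 - E`. -/
def Reflects (R : T.Space → T.Space) (E : Set (Occ m)) : Prop :=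
  ∀ f, VanishesOn (R f) (reflSet E) ↔ VanishesOn f E

variable {R : T.Space →ₛₗᵢ[starRingEnd ℂ] T.Space}

theorem Reflects.compl (hR : Function.Involutive R) {E : Set (Occ m)} (hE : MeasurableSet E)
    (h : Reflects R E) : Reflects R Eᶜ := fun f => by
  rw [reflSet, Set.preimage_compl, vanishesOn_compl_iff (measurableSet_reflSet hE),
    vanishesOn_compl_iff hE, hR.surjective.forall]
  refine forall_congr' fun g => imp_congr (h g) ?_
  rw [inner_map_map_of_antilinear, map_eq_zero]

theorem Reflects.iUnion {R : T.Space → T.Space} {E : ℕ → Set (Occ m)}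
    (h : ∀ n, Reflects R (E n)) : Reflects R (⋃ n, E n) := fun f => by
  rw [reflSet, Set.preimage_iUnion, vanishesOn_iUnion, vanishesOn_iUnion]
  exact forall_congr' fun n => h n f

theorem reflects_coordinate (hS : ∀ k f, R (T.opS k (T.opZ k f)) = T.opS k (T.opZ k (R f)))
    (k : Idx m) (a : ZMod 2) : Reflects R {x | x k = a} := fun f => by
  have hrefl : reflSet {x : Occ m | x k = a} = {x | x k = a + 1} := by
    ext x
    exact (by revert a; decide : ∀ b : ZMod 2, b + 1 = a ↔ b = a + 1) (x k)
  have hconj : ((-1 : ℂ) ^ (a + 1).val * Complex.I) • R f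
      = R (((-1 : ℂ) ^ a.val * Complex.I) • f) := by
    rw [LinearIsometry.map_smulₛₗ, sign_add_one]
    simp
  rw [hrefl, vanishesOn_coordinate_iff, vanishesOn_coordinate_iff, ← hS, hconj,
    R.injective.eq_iff]

variable (hR : Function.Involutive R)
  (hS : ∀ k f, R (T.opS k (T.opZ k f)) = T.opS k (T.opZ k (R f)))
include hR hS

theorem reflects_of_measurableSet {E : Set (Occ m)} (hE : MeasurableSet E) : Reflects R E := by
  let M : MeasurableSpace (Occ m) :=
    { MeasurableSet' := fun E => MeasurableSet E ∧ Reflects R E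
      measurableSet_empty := ⟨.empty, fun f => by simp [VanishesOn]⟩
      measurableSet_compl := fun E h => ⟨h.1.compl, h.2.compl hR h.1⟩
      measurableSet_iUnion := fun E h => ⟨.iUnion fun n => (h n).1, .iUnion fun n => (h n).2⟩ }
  have hM : MeasurableSpace.pi ≤ M := by
    refine iSup_le fun k => measurable_iff_comap_le.1 (measurable_to_countable' fun a => ?_)
    exact ⟨measurable_pi_apply k (measurableSet_singleton a), reflects_coordinate hS k a⟩
  exact (hM E hE).2

theorem map_cut {E : Set (Occ m)} (hE : MeasurableSet E) (f : T.Space) :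
    R (cut hE f) = cut (measurableSet_reflSet hE) (R f) := by
  have hin : VanishesOn (R (cut hE f)) (reflSet Eᶜ) :=
    (reflects_of_measurableSet hR hS hE.compl _).2 (vanishesOn_cut_compl hE f)
  have hout : VanishesOn (R (cut hE.compl f)) (reflSet E) :=
    (reflects_of_measurableSet hR hS hE _).2
      (by simpa only [compl_compl] using vanishesOn_cut_compl hE.compl f)
  have hsum : (R f).1 =ᵐ[T.μ] (R (cut hE f)).1 + (R (cut hE.compl f)).1 := by
    conv_lhs => rw [← cut_add_cut_compl hE f, map_add]
    exact Lp.coeFn_add _ _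
  refine space_ext (.trans ?_ (coeFn_cut _ _).symm)
  filter_upwards [hin, hout, hsum] with x hin hout hsum
  by_cases hx : x ∈ reflSet E
  · rw [Set.indicator_of_mem hx, hsum, Pi.add_apply, hout hx, add_zero]
  · rw [Set.indicator_of_notMem hx, hin hx]

theorem quasiMeasurePreserving_reflection :
    Measure.QuasiMeasurePreserving (· + (1 : Occ m)) T.μ T.μ := by
  refine ⟨measurable_add_const 1, Measure.AbsolutelyContinuous.mk fun E hE hμE => ?_⟩
  obtain ⟨w, s, hs⟩ := T.exists_isFrame
  have hvanish : VanishesOn (R (s 0)) E := by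
    filter_upwards [measure_eq_zero_iff_ae_notMem.1 hμE] with x hx hxE
    exact absurd hxE hx
  rw [← reflects_of_measurableSet hR hS hE, hR] at hvanish
  rw [Measure.map_apply (measurable_add_const 1) hE, measure_eq_zero_iff_ae_notMem]
  filter_upwards [hvanish, hs.coeFn 0] with x hx hsx hxE
  have hν : T.ν x ≠ 0 := (zero_lt_one.trans_le (T.one_le_ν x)).ne'
  have h0 := congrArg (fun v : Ell2 => v 0) (hsx.symm.trans (hx hxE))
  simp [fiberBasis_apply, hν, (hs.pos x).ne'] at h0

/-- Testing the antiunitarity of `R` against the restrictions of `f` to all measurable sets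
localizes it to almost every point. -/
theorem inner_map_map_ae (f g : T.Space) :
    ∀ᵐ x ∂T.μ, inner ℂ ((R f).1 x) ((R g).1 x)
      = (T.density 1 x).toReal • conj (inner ℂ (f.1 (x + 1)) (g.1 (x + 1))) := by
  have hac := (quasiMeasurePreserving_reflection hR hS).absolutelyContinuous
  have hreflect (F : Occ m → ℂ) (x : Occ m) : F (translate 1 x + 1) = F x :=
    congrArg F (Occ.add_add_cancel x 1)
  have hint : Integrable (fun x => conj (inner ℂ (f.1 (x + 1)) (g.1 (x + 1))))
      (T.μ.map (· + 1)) := by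
    refine (integrable_map_equiv (translate 1) _).2 ?_
    refine (Complex.conjLIE.toContinuousLinearEquiv.toContinuousLinearMap.integrable_comp
      (L2.integrable_inner (𝕜 := ℂ) f.1 g.1)).congr (.of_forall fun x => ?_)
    exact (hreflect (fun y => conj (inner ℂ (f.1 y) (g.1 y))) x).symm
  refine Integrable.ae_eq_of_forall_setIntegral_eq _ _ (L2.integrable_inner (R f).1 (R g).1)
    ((integrable_rnDeriv_smul_iff hac).2 hint) fun E hE _ => ?_
  have hcut := inner_map_map_of_antilinear R (cut (measurableSet_reflSet hE) f) g
  rw [map_cut hR hS, inner_cut_left, inner_cut_left] at hcut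
  simp only [reflSet_reflSet] at hcut
  calc ∫ x in E, inner ℂ ((R f).1 x) ((R g).1 x) ∂T.μ
      = ∫ x in reflSet E, conj (inner ℂ (f.1 x) (g.1 x)) ∂T.μ := by rw [hcut, ← integral_conj]
    _ = ∫ x in E, conj (inner ℂ (f.1 (x + 1)) (g.1 (x + 1))) ∂T.μ.map (· + 1) := by
        refine .trans ?_ ((translate 1).measurableEmbedding.setIntegral_map _ _).symm
        exact integral_congr_ae (.of_forall fun x =>
          (hreflect (fun y => conj (inner ℂ (f.1 y) (g.1 y))) x).symm)
    _ = ∫ x in E, (T.density 1 x).toReal • conj (inner ℂ (f.1 (x + 1)) (g.1 (x + 1))) ∂T.μ :=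
        (setIntegral_rnDeriv_smul hac hE).symm

end Reflection

end Triple

/-! ### Operator coefficients of antiunitary involutions -/

section Orthogonal

variable {𝕜 E : Type*} [RCLike 𝕜] [NormedAddCommGroup E] [InnerProductSpace 𝕜 E] {y : ℕ → E}

theorem orthogonalFamily_span_singleton (hy : Pairwise fun i j => inner 𝕜 (y i) (y j) = 0) :
    OrthogonalFamily 𝕜 (fun i => Submodule.span 𝕜 {y i})
      fun i => (Submodule.span 𝕜 {y i}).subtypeₗᵢ :=
  .of_pairwise fun i j hij => Submodule.isOrtho_span.2 (by rintro _ rfl _ rfl; exact hy hij)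

theorem hasSum_norm_sq_of_pairwise_inner_eq_zero
    (hy : Pairwise fun i j => inner 𝕜 (y i) (y j) = 0) {a : E} (ha : HasSum y a) :
    HasSum (fun i => ‖y i‖ ^ 2) (‖a‖ ^ 2) :=
  (ha.norm.pow 2).congr fun s => (orthogonalFamily_span_singleton hy).norm_sum
    (fun i => ⟨y i, Submodule.mem_span_singleton_self _⟩) s

theorem summable_of_pairwise_inner_eq_zero [CompleteSpace E]
    (hy : Pairwise fun i j => inner 𝕜 (y i) (y j) = 0) (hs : Summable fun i => ‖y i‖ ^ 2) :
    Summable y :=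
  ((orthogonalFamily_span_singleton hy).summable_iff_norm_sq_summable
    fun i => ⟨y i, Submodule.mem_span_singleton_self _⟩).2 hs

end Orthogonal

section ConjSynthesis

open ComplexConjugate

theorem hasSum_norm_sq (v : Ell2) : HasSum (fun i => ‖v i‖ ^ 2) (‖v‖ ^ 2) := by
  simpa using lp.hasSum_norm (p := 2) (by norm_num) v

namespace OrthonormalBelow

variable {n : ℕ∞} {u : ℕ → Ell2}

theorem norm_eq (hu : OrthonormalBelow n u) (i : ℕ) : ‖u i‖ = if (i : ℕ∞) < n then 1 else 0 := by
  have h : ‖u i‖ ^ 2 = if (i : ℕ∞) < n then 1 else 0 := by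
    rw [← inner_self_eq_norm_sq (𝕜 := ℂ), hu i i]
    split_ifs <;> simp_all
  rw [← Real.sqrt_sq (norm_nonneg (u i)), h]
  split_ifs <;> simp

theorem pairwise_inner_conj_smul (hu : OrthonormalBelow n u) (v : Ell2) :
    Pairwise fun i j => inner ℂ (conj (v i) • u i) (conj (v j) • u j) = 0 := fun i j hij => by
  beta_reduce
  rw [inner_smul_left, inner_smul_right, hu i j, if_neg fun h => hij h.1, mul_zero, mul_zero]

theorem norm_conj_smul_le (hu : OrthonormalBelow n u) (v : Ell2) (i : ℕ) :
    ‖conj (v i) • u i‖ ^ 2 ≤ ‖v i‖ ^ 2 := by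
  rw [norm_smul, RCLike.norm_conj, hu.norm_eq]
  split_ifs <;> simp

theorem norm_conj_smul_of_mem_fiber (hu : OrthonormalBelow n u) {v : Ell2} (hv : v ∈ fiber n)
    (i : ℕ) : ‖conj (v i) • u i‖ = ‖v i‖ := by
  rw [norm_smul, RCLike.norm_conj, hu.norm_eq]
  split_ifs with hi
  · rw [mul_one]
  · rw [hv i (not_lt.1 hi), norm_zero, zero_mul]

theorem summable_conj_smul (hu : OrthonormalBelow n u) (v : Ell2) :
    Summable fun i => conj (v i) • u i :=
  summable_of_pairwise_inner_eq_zero (hu.pairwise_inner_conj_smul v)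
    ((hasSum_norm_sq v).summable.of_nonneg_of_le (fun _ => by positivity)
      (hu.norm_conj_smul_le v))

/-- The antilinear operator that maps the standard basis of `H_n` to the sequence `u`. -/
def conjSynthesis (hu : OrthonormalBelow n u) : Ell2 →L⋆[ℂ] Ell2 :=
  LinearMap.mkContinuous
    { toFun := fun v => ∑' i, conj (v i) • u i
      map_add' := fun v w => by
        rw [← (hu.summable_conj_smul v).tsum_add (hu.summable_conj_smul w)]
        simp [add_smul]
      map_smul' := fun a v => by
        rw [← (hu.summable_conj_smul v).tsum_const_smul]
        simp [mul_smul] } 1 fun v => by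
    rw [one_mul]
    exact (pow_le_pow_iff_left₀ (norm_nonneg _) (norm_nonneg _) two_ne_zero).1
      (hasSum_le (hu.norm_conj_smul_le v) (hasSum_norm_sq_of_pairwise_inner_eq_zero
        (hu.pairwise_inner_conj_smul v) (hu.summable_conj_smul v).hasSum) (hasSum_norm_sq v))

theorem hasSum_conjSynthesis (hu : OrthonormalBelow n u) (v : Ell2) :
    HasSum (fun i => conj (v i) • u i) (hu.conjSynthesis v) :=
  (hu.summable_conj_smul v).hasSum

theorem conjSynthesis_fiberBasis (hu : OrthonormalBelow n u) (i : ℕ) :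
    hu.conjSynthesis (fiberBasis n i) = u i := by
  refine (hu.hasSum_conjSynthesis _).unique ?_
  convert hasSum_ite_eq i (u i) using 2 with j
  rw [fiberBasis_apply]
  by_cases hj : (j : ℕ∞) < n
  · by_cases hij : i = j <;> simp_all [eq_comm]
  · have huj : u j = 0 := norm_eq_zero.1 ((hu.norm_eq j).trans (if_neg hj))
    by_cases hij : i = j <;> simp_all [eq_comm]

theorem norm_conjSynthesis (hu : OrthonormalBelow n u) {v : Ell2} (hv : v ∈ fiber n) :
    ‖hu.conjSynthesis v‖ = ‖v‖ := by
  refine (pow_left_inj₀ (norm_nonneg _) (norm_nonneg _) two_ne_zero).1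
    ((hasSum_norm_sq_of_pairwise_inner_eq_zero (hu.pairwise_inner_conj_smul v)
      (hu.hasSum_conjSynthesis v)).unique ?_)
  simpa only [hu.norm_conj_smul_of_mem_fiber hv] using hasSum_norm_sq v

theorem conjSynthesis_mem_fiber (hu : OrthonormalBelow n u) {d : ℕ∞} (hmem : ∀ i, u i ∈ fiber d)
    (v : Ell2) : hu.conjSynthesis v ∈ fiber d :=
  (isClosed_fiber d).mem_of_tendsto (hu.hasSum_conjSynthesis v) (.of_forall fun _ =>
    Submodule.sum_mem _ fun i _ => Submodule.smul_mem _ _ (hmem i))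

end OrthonormalBelow

theorem stronglyMeasurable_conjSynthesis {α : Type*} [MeasurableSpace α] {n : α → ℕ∞}
    {u : ℕ → α → Ell2} (hu : ∀ x, OrthonormalBelow (n x) fun i => u i x)
    (hmeas : ∀ i, StronglyMeasurable (u i)) (v : Ell2) :
    StronglyMeasurable fun x => (hu x).conjSynthesis v :=
  stronglyMeasurable_of_tendsto Filter.atTop
    (fun N => Finset.stronglyMeasurable_fun_sum (Finset.range N) fun i _ =>
      (hmeas i).fun_const_smul (conj (v i)))
    (tendsto_pi_nhds.2 fun x => ((hu x).hasSum_conjSynthesis v).tendsto_sum_nat)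

end ConjSynthesis

namespace Triple

open ComplexConjugate

variable {T : Triple m}

theorem exists_isIsometricField_apply_fiberBasis {δ : Occ m} {u : ℕ → Occ m → Ell2}
    (hδ : Measure.QuasiMeasurePreserving (· + δ) T.μ T.μ)
    (hν : ∀ᵐ x ∂T.μ, T.ν (x + δ) = T.ν x) (hmeas : ∀ i, StronglyMeasurable (u i))
    (hu : ∀ᵐ x ∂T.μ, OrthonormalBelow (T.ν x) fun i => u i x)
    (hmem : ∀ᵐ x ∂T.μ, ∀ i, u i x ∈ fiber (T.ν x)) :
    ∃ r : Occ m → (Ell2 →L⋆[ℂ] Ell2), T.IsIsometricField δ r ∧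
      ∀ᵐ x ∂T.μ, ∀ i, r x (fiberBasis (T.ν x) i) = u i x := by
  classical
  obtain ⟨G, hGae, hG, hGu⟩ := hu.exists_measurable_mem
  have hu' : ∀ x, OrthonormalBelow (if x ∈ G then T.ν x else 0) fun i => G.indicator (u i) x := by
    intro x
    by_cases hx : x ∈ G
    · simpa only [hx, if_true, Set.indicator_of_mem] using hGu x hx
    · simp [OrthonormalBelow, hx]
  have hr : ∀ᵐ x ∂T.μ, ∀ v ∈ fiber (T.ν x), (hu' x).conjSynthesis v ∈ fiber (T.ν x) ∧
      ‖(hu' x).conjSynthesis v‖ = ‖v‖ := by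
    filter_upwards [hGae, hmem] with x hx hmem v hv
    exact ⟨(hu' x).conjSynthesis_mem_fiber (by simpa [hx] using hmem) v,
      (hu' x).norm_conjSynthesis (by rwa [if_pos hx])⟩
  refine ⟨fun x => (hu' x).conjSynthesis, ⟨hδ, hν,
    stronglyMeasurable_conjSynthesis hu' fun i => (hmeas i).indicator hG,
    hr.mono fun x hx v hv => (hx v hv).1, hr.mono fun x hx v hv => (hx v hv).2⟩, ?_⟩
  filter_upwards [hGae] with x hx i
  simpa [hx] using (hu' x).conjSynthesis_fiberBasis i

theorem inner_real_smul_real_smul (a b : ℝ) (v w : Ell2) :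
    inner ℂ (a • v) (b • w) = (a * b) • inner ℂ v w := by
  rw [inner_smul_left_eq_star_smul, inner_smul_right_eq_smul, starRingEnd_apply,
    star_trivial, smul_smul]

theorem IsIsometricField.inner_shift_ae {δ : Occ m} {r : Occ m → (Ell2 →L⋆[ℂ] Ell2)}
    (hr : T.IsIsometricField δ r) (f g : T.Space) :
    ∀ᵐ x ∂T.μ, inner ℂ ((hr.shift f).1 x) ((hr.shift g).1 x)
      = (T.density δ x).toReal • conj (inner ℂ (f.1 (x + δ)) (g.1 (x + δ))) := by
  filter_upwards [hr.isWeightedShift_shift f, hr.isWeightedShift_shift g,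
    hr.translate_mem_fiber f, hr.translate_mem_fiber g, hr.norm_map] with x hf hg hmf hmg hnorm
  rw [hf, hg, weightedShift, weightedShift, inner_real_smul_real_smul,
    Real.mul_self_sqrt ENNReal.toReal_nonneg]
  exact congrArg _ (inner_map_map_of_norm_eq (r x).toLinearMap hnorm hmf hmg)

section Antiunitary

variable {R : T.Space →ₛₗᵢ[starRingEnd ℂ] T.Space} (hR : Function.Involutive R)
  (hS : ∀ k f, R (T.opS k (T.opZ k f)) = T.opS k (T.opZ k (R f))) {w : Occ m → ℝ}
  {s : ℕ → T.Space}
include hR hS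

theorem IsFrame.exists_orthonormalBelow (hs : T.IsFrame w s) :
    ∃ u : ℕ → Occ m → Ell2, (∀ i, StronglyMeasurable (u i)) ∧
      (∀ᵐ x ∂T.μ, OrthonormalBelow (T.ν (x + 1)) fun i => u i x) ∧
      (∀ᵐ x ∂T.μ, ∀ i, u i x ∈ fiber (T.ν x)) ∧
      ∀ᵐ x ∂T.μ, ∀ i, (R (s i)).1 x = (√(T.density 1 x).toReal * w (x + 1)) • u i x := by
  have hq := quasiMeasurePreserving_reflection hR hS
  have hc : Measurable fun x => √(T.density 1 x).toReal * w (x + 1) :=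
    ((Measure.measurable_rnDeriv _ _).ennreal_toReal.sqrt).mul
      (hs.measurable.comp (measurable_add_const 1))
  have hpos : ∀ᵐ x ∂T.μ, 0 < √(T.density 1 x).toReal * w (x + 1) := by
    filter_upwards [T.density_toReal_pos hq] with x hx
    exact mul_pos (Real.sqrt_pos.2 hx) (hs.pos _)
  refine ⟨fun i x => (√(T.density 1 x).toReal * w (x + 1))⁻¹ • (R (s i)).1 x,
    fun i => hc.inv.stronglyMeasurable.smul (Lp.stronglyMeasurable _), ?_, ?_, ?_⟩
  · filter_upwards [ae_all_iff.2 fun i => ae_all_iff.2 fun j => inner_map_map_ae hR hS (s i) (s j),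
      ae_all_iff.2 fun i => hq.ae (hs.coeFn i), hpos] with x hinner hsx hpos i j
    have hsq : (T.density 1 x).toReal * (w (x + 1) * w (x + 1))
        = (√(T.density 1 x).toReal * w (x + 1)) * (√(T.density 1 x).toReal * w (x + 1)) := by
      rw [mul_mul_mul_comm, Real.mul_self_sqrt ENNReal.toReal_nonneg]
    beta_reduce
    rw [inner_real_smul_real_smul, hinner, hsx, hsx, inner_real_smul_real_smul,
      orthonormalBelow_fiberBasis i j, RCLike.conj_smul, smul_smul, smul_smul,
      mul_assoc _ _ (w _ * w _), hsq, mul_mul_mul_comm, inv_mul_cancel₀ hpos.ne', mul_one,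
      one_smul]
    split_ifs <;> simp
  · filter_upwards [ae_all_iff.2 fun i => (R (s i)).2] with x hx i
    exact (fiber _).smul_of_tower_mem _ (hx i)
  · filter_upwards [hpos] with x hx i
    rw [smul_inv_smul₀ hx.ne']

theorem IsFrame.eq_of_eq_on_frame (hs : T.IsFrame w s) {P : T.Space → T.Space}
    (hP : ∀ f g, ∀ᵐ x ∂T.μ, inner ℂ ((P f).1 x) ((P g).1 x)
      = (T.density 1 x).toReal • conj (inner ℂ (f.1 (x + 1)) (g.1 (x + 1))))
    (hPs : ∀ i, P (s i) = R (s i)) : P = R := by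
  have hq := quasiMeasurePreserving_reflection hR hS
  refine funext fun f => sub_eq_zero.1 (hR.injective ?_)
  rw [map_zero]
  have horth : ∀ i, ∀ᵐ x ∂T.μ, inner ℂ ((R (s i)).1 x) ((P f - R f).1 x) = 0 := fun i => by
    filter_upwards [hP (s i) f, inner_map_map_ae hR hS (s i) f, Lp.coeFn_sub (P f).1 (R f).1]
      with x hx hx' hsub
    change inner ℂ _ (((P f).1 - (R f).1 : Lp Ell2 2 T.μ) x) = 0
    rw [hsub, Pi.sub_apply, inner_sub_right, hx', ← hx, hPs, sub_self]
  refine hs.eq_zero_of_inner_eq_zero fun i => ?_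
  filter_upwards [inner_map_map_ae hR hS (R (s i)) (P f - R f), hq.ae (horth i)] with x hx h0
  rw [hR] at hx
  rw [hx, h0, map_zero, smul_zero]

theorem exists_isWeightedShift_one :
    ∃ r : Occ m → (Ell2 →L⋆[ℂ] Ell2), T.IsIsometricField 1 r ∧ IsWeightedShift R 1 r := by
  have hq := quasiMeasurePreserving_reflection hR hS
  obtain ⟨w, s, hs⟩ := T.exists_isFrame
  obtain ⟨u, hmeas, hu, hmem, hRs⟩ := hs.exists_orthonormalBelow hR hS
  have hle : ∀ᵐ x ∂T.μ, T.ν (x + 1) ≤ T.ν x := by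
    filter_upwards [hu, hmem] with x hx hmem using hx.le_of_mem_fiber hmem
  have hν : ∀ᵐ x ∂T.μ, T.ν (x + 1) = T.ν x := by
    filter_upwards [hle, hq.ae hle] with x hx hx'
    rw [Occ.add_add_cancel] at hx'
    exact hx.antisymm hx'
  obtain ⟨r, hr, hru⟩ := exists_isIsometricField_apply_fiberBasis hq hν hmeas
    (by filter_upwards [hu, hν] with x hx hν; rwa [← hν]) hmem
  have hshift : ∀ i, hr.shift (s i) = R (s i) := fun i => space_ext (by
    filter_upwards [hr.isWeightedShift_shift (s i), hq.ae (hs.coeFn i), hν, hru, hRs]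
      with x hx hsx hν hru hRs
    rw [hx, weightedShift, hsx, map_real_smul (r x) (r x).continuous, hν, hru, hRs, smul_smul])
  refine ⟨r, hr, ?_⟩
  rw [← hs.eq_of_eq_on_frame hR hS hr.inner_shift_ae hshift]
  exact hr.isWeightedShift_shift

end Antiunitary

end Triple

namespace Triple

variable {T : Triple m}

theorem exists_isInvariantRealForm_iff_exists_isIsometricField {Z : Type*} [NormedAddCommGroup Z]
    [InnerProductSpace ℝ Z] (b : HilbertBasis (Idx m ⊕ Idx m) ℝ Z) :
    (∃ V, IsInvariantRealForm (T.rep b) V) ↔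
      ∃ r : Occ m → (Ell2 →L⋆[ℂ] Ell2), T.IsIsometricField 1 r ∧
        (∀ᵐ x ∂T.μ, ∀ v ∈ fiber (T.ν x), r x (r (x + 1) v) = v) ∧
        ∀ k : Idx m, ∀ᵐ x ∂T.μ, ∀ v ∈ fiber (T.ν x),
          r x (T.c k (x + 1) v) = (-1 : ℂ) ^ (k : ℕ) • T.c k x (r (x + delta k) v) := by
  rw [T.exists_isInvariantRealForm_iff b]
  constructor
  · rintro ⟨R, hR, hcomm⟩
    obtain ⟨r, hr, hRr⟩ := exists_isWeightedShift_one hR fun k f => by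
      rw [(hcomm k _).2, (hcomm k f).1]
    exact ⟨r, hr, (hRr.involutive_iff hr).1 hR, fun k =>
      (hRr.commute_op_iff hr _ _ (conj_phaseZ_add_one k)).1 fun f => (hcomm k f).1⟩
  · rintro ⟨r, hr, hrr, hrc⟩
    have hRr := hr.isWeightedShift_shift
    exact ⟨hr.shift, (hRr.involutive_iff hr).2 hrr, fun k f =>
      ⟨(hRr.commute_op_iff hr _ _ (conj_phaseZ_add_one k)).2 (hrc k) f,
        (hRr.commute_op_iff hr _ _ (conj_phaseS_add_one k)).2 (hrc k) f⟩⟩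

theorem absolutelyContinuous_map_add_one (h : T.μ.map (· + 1) ≪ T.μ) : T.μ ≪ T.μ.map (· + 1) := by
  have h' := h.map (measurable_add_const (1 : Occ m))
  rwa [Measure.map_map (measurable_add_const 1) (measurable_add_const 1),
    show (· + (1 : Occ m)) ∘ (· + 1) = id from funext fun x => Occ.add_add_cancel x 1,
    Measure.map_id] at h'

theorem isIsometricField_one_iff {r : Occ m → (Ell2 →L⋆[ℂ] Ell2)} :
    T.IsIsometricField 1 r ↔
      (T.μ ≪ T.μ.map (· + 1) ∧ T.μ.map (· + 1) ≪ T.μ) ∧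
      (∀ᵐ x ∂T.μ, T.ν x = T.ν (x + 1)) ∧
      (∀ v, StronglyMeasurable fun x => r x v) ∧
      ∀ᵐ x ∂T.μ, ∀ v ∈ fiber (T.ν x), r x v ∈ fiber (T.ν (x + 1)) ∧ ‖r x v‖ = ‖v‖ := by
  constructor
  · intro hr
    have hac := hr.quasiMeasurePreserving.absolutelyContinuous
    refine ⟨⟨absolutelyContinuous_map_add_one hac, hac⟩, hr.ν_add.mono fun _ => Eq.symm,
      hr.stronglyMeasurable, ?_⟩
    filter_upwards [hr.ν_add, hr.mem_fiber, hr.norm_map] with x hν hmem hnorm v hv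
    exact ⟨hν ▸ hmem v hv, hnorm v hv⟩
  · rintro ⟨⟨-, hac⟩, hν, hmeas, hisom⟩
    refine ⟨⟨measurable_add_const 1, hac⟩, hν.mono fun _ => Eq.symm, hmeas, ?_,
      hisom.mono fun x hx v hv => (hx v hv).2⟩
    filter_upwards [hν, hisom] with x hν hx v hv
    exact hν ▸ (hx v hv).1

end Triple

end GW

end

theorem theorem3p5 {m : ℕ∞} {Z : Type*} [NormedAddCommGroup Z] [InnerProductSpace ℝ Z]
    (b : HilbertBasis (GW.Idx m ⊕ GW.Idx m) ℝ Z) (T : GW.Triple m) :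
    (∃ V : Submodule ℝ T.Space, GW.IsInvariantRealForm (T.rep b) V) ↔
      (T.μ ≪ T.μ.map (1 - ·) ∧ T.μ.map (1 - ·) ≪ T.μ) ∧
      (∀ᵐ x ∂T.μ, T.ν x = T.ν (1 - x)) ∧
      ∃ r : GW.Occ m → (GW.Ell2 →L⋆[ℂ] GW.Ell2),
        (∀ v, StronglyMeasurable fun x => r x v) ∧
        (∀ᵐ x ∂T.μ, ∀ v ∈ GW.fiber (T.ν x),
          r x v ∈ GW.fiber (T.ν (1 - x)) ∧ ‖r x v‖ = ‖v‖) ∧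
        (∀ᵐ x ∂T.μ, ∀ v ∈ GW.fiber (T.ν x), r x (r (1 - x) v) = v) ∧
        (∀ k : GW.Idx m, ∀ᵐ x ∂T.μ, ∀ v ∈ GW.fiber (T.ν x),
          r x (T.c k (1 - x) v) = (-1 : ℂ) ^ (k : ℕ) • T.c k x (r (x + GW.delta k) v)) := by
  simp only [GW.Occ.one_sub_eq]
  rw [GW.Triple.exists_isInvariantRealForm_iff_exists_isIsometricField b]
  simp only [GW.Triple.isIsometricField_one_iff, and_assoc, exists_and_left]
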